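/- **Setting.** Let $k,a>0$. For $\bm s=(s_1,s_2,s_3)\in\mathbb R^3$ let $\Phi_{\bm s}\in L^2(\mathbb R^2)$ be the pupil function $$\Phi_{\bm s}(\bm r)=\frac{1}{\sqrt\pi\,a}\,\mathrm{circ}(r/a)\,\exp\!\big[ik(s_1x_1+s_2x_2-s_3r^2/2)\big],\qquad \bm r=(x_1,x_2),\ r=|\bm r|,$$ where $\mathrm{circ}(r/a)=1$ for $r\le a$ and $0$ otherwise. Let $|\Psi_{\bm s}\rangle=e^{i\theta_{\bm s}}|\Phi_{\bm s}\rangle$, where $\theta_{-\bm s}=-\theta_{\bm s}$ and $\Delta_{\bm s}=e^{2i\theta_{\bm s}}\int\Phi_{\bm s}^2\,d\bm r$ is real. The one-photon state of two incoherent point sources at $\pm\bm s$ is $$\rho_{\bm s}=\tfrac12|\Psi_{\bm s}\rangle\langle\Psi_{\bm s}|+\tfrac12|\Psi_{-\bm s}\rangle\langle\Psi_{-\bm s}|,$$ and $|\tilde\psi_{1\bm s}\rangle=|\Psi_{\bm s}\rangle+|\Psi_{-\bm s}\rangle$, $|\tilde\psi_{2\bm s}\rangle=-i(|\Psi_{\bm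 s}\rangle-|\Psi_{-\bm s}\rangle)$. Fix $s_3\neq0$ and consider the estimation of the transverse separation $\bm s_\perp=(s_1,s_2)$ at $\bm s_\perp=0$, with $\theta$ differentiable in $\bm s_\perp$ there; $\partial_i=\partial/\partial s_i$, $i=1,2$. Let $L_i$ be symmetric logarithmic derivatives at $\bm s_\perp=0$: $L_i=L_i^\dagger$ and $(L_i\rho+\rho L_i)/2=\partial_i\rho$ (bounded ones exist, and the statements below hold for every choice of them). For a projector $\Pi_k=\sum_\alpha|\pi_{k\alpha}\rangle\langle\pi_{k\alpha}|$ with orthonormal $|\pi_{k\alpha}\rangle$ put $$\mathcal F^k_{ij}=\frac{\partial_i\mathrm{Tr}(\rho\,\Pi_k)\,\partial_j\mathrm{Tr}(\rho\,\Pi_k)}{\mathrm{Tr}(\rho\,\Pi_k)},\qquad \mathcal I^k_{ij}=\mathrm{Re}\,\mathrm{Tr}(\rho L_i\Pi_kL_j),\qquad T^k_{ij}=\tfrac12\partial_i\partial_j\mathrm{Tr}(\rho\,\Pi_k).$$ The projector is *null* if $\mathrm{Tr}(\rho\,\Pi_k)=0$ at $\bm s_\perp=0$, and *regular* otherwise.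 Its matrix bound is *saturated* if $\mathcal F^k_{ij}=\mathcal I^k_{ij}$ at $\bm s_\perp=0$ for $i,j=1,2$. If $\Pi_k$ is null, $\mathcal F^k_{ij}$ is of the form $0/0$ there, and the equality means $\lim_{t\to0}\mathcal F^k_{ij}(t\bm\delta)=\mathcal I^k_{ij}$ for every direction $\bm\delta\in\mathbb R^2$ with $\sum_{pq}T^k_{pq}\delta_p\delta_q\ne0$ at $\bm s_\perp=0$; if $T^k=0$ there, it means that $\mathcal F^k_{ij}(\bm s_\perp)\to\mathcal I^k_{ij}$ as $\bm s_\perp\to0$ through points where $\mathrm{Tr}(\rho\,\Pi_k)\neq0$. **Corollary.** At $\bm s_\perp=0$, $s_3\ne0$: 1. The matrix bound of a regular projector $\Pi_k$ is saturated if and only if there are real $\xi_1^k,\xi_2^k$, independent of $n$ and $\alpha$, with $$\langle\partial_i\tilde\psi_{n\bm s}|\pi_{k\alpha}\rangle=\xi_i^k\,\langle\tilde\psi_{n\bm s}|\pi_{k\alpha}\rangle\qquad\text{for } i=1,2,\ n=1,2\text{ and all }\alpha.$$ 2. The matrix bound of a null projector $\Pi_k$ is saturated if and only if for all $i,j\in\{1,2\}$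 there is a real $\eta^k_{ij}$, independent of $n$ and $\alpha$, with $\langle\partial_i\tilde\psi_{n\bm s}|\pi_{k\alpha}\rangle=\eta^k_{ij}\langle\partial_j\tilde\psi_{n\bm s}|\pi_{k\alpha}\rangle$ for $n=1,2$ and all $\alpha$, or a real $\eta^k_{ji}$, independent of $n$ and $\alpha$, with $\langle\partial_j\tilde\psi_{n\bm s}|\pi_{k\alpha}\rangle=\eta^k_{ji}\langle\partial_i\tilde\psi_{n\bm s}|\pi_{k\alpha}\rangle$ for $n=1,2$ and all $\alpha$. 3. Let $|Z_n^m\rangle$ be the normalized real Zernike functions on the disc $r\le a$ (extended by zero), with angular part $\cos m\phi$ for $m\ge0$ and $\sin|m|\phi$ for $m<0$. The operators $$\Pi_2=\sum_{n=0}^\infty|Z_{2n+1}^{1}\rangle\langle Z_{2n+1}^{1}|,\qquad \Pi_3=\sum_{n=0}^\infty|Z_{2n+1}^{-1}\rangle\langle Z_{2n+1}^{-1}|,\qquad \Pi_1=1-\Pi_2-\Pi_3$$ are projectors forming an optimal measurement: $\Pi_1$ is regular, $\Pi_2$ and $\Pi_3$ are null, and all three matrix bounds are saturated. Consequently $\lim_{t\to0}\sum_{k=1}^3\mathcal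 F^k_{ij}(t\bm\delta)=\mathrm{Re}\,\mathrm{Tr}(\rho L_iL_j)$ at $\bm s_\perp=0$ for $i,j=1,2$ and every direction $\bm\delta$ with $\delta_1\delta_2\neq0$. -/

import Mathlib

open MeasureTheory Filter Topology

/-! ## Quantum multiparameter estimation on a complex Hilbert space -/

namespace QuantumEstimation

section General

/-- The trace `∑ ⟨e, A e⟩` of an operator, over a Hilbert basis of `H` (the value does not depend
on the basis for trace class operators, in particular for the finite rank operators met here). -/
noncomputable def trace {H : Type*} [NormedAddCommGroup H] [InnerProductSpace ℂ H]
    [CompleteSpace H] (A : H →L[ℂ] H) : ℂ :=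
  ∑' e : (exists_hilbertBasis ℂ H).choose, inner ℂ (e : H) (A (e : H))

/-- `Tr |x⟩⟨y| = ⟨y, x⟩`, whatever the Hilbert basis chosen in `trace`. -/
theorem trace_rankOne {H : Type*} [NormedAddCommGroup H] [InnerProductSpace ℂ H]
    [CompleteSpace H] (x y : H) :
    trace (InnerProductSpace.rankOne ℂ x y) = inner ℂ y x := by
  obtain ⟨b, hb⟩ := (exists_hilbertBasis ℂ H).choose_spec
  have h := b.hasSum_inner_mul_inner y x
  rw [trace, ← h.tsum_eq]
  refine tsum_congr fun e => ?_
  have he : b e = (e : H) := congrFun hb e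
  rw [he, InnerProductSpace.inner_right_rankOne_apply]
  ring

/-- The partial derivative `∂ᵢ f` at `v` (`E` is normed, e.g. vectors or bounded operators). -/
noncomputable def pderiv {ι E : Type*} [DecidableEq ι] [NormedAddCommGroup E] [NormedSpace ℝ E]
    (i : ι) (f : (ι → ℝ) → E) (v : ι → ℝ) : E :=
  lineDeriv ℝ f v (Pi.single i 1)

/-- The outcome probability `Tr (ρ_v Π)`. -/
noncomputable def prob {ι H : Type*} [NormedAddCommGroup H] [InnerProductSpace ℂ H]
    [CompleteSpace H] (ρ : (ι → ℝ) → H →L[ℂ] H) (P : H →L[ℂ] H) (v : ι → ℝ) : ℝ :=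
  (trace (ρ v * P)).re

/-- A POVM operator is null at `v` if `Tr (ρ_v Π) = 0`, and regular otherwise. -/
def IsNull {ι H : Type*} [NormedAddCommGroup H] [InnerProductSpace ℂ H]
    [CompleteSpace H] (ρ : (ι → ℝ) → H →L[ℂ] H) (P : H →L[ℂ] H) (v : ι → ℝ) : Prop :=
  trace (ρ v * P) = 0

/-- The contribution `∂ᵢ Tr (ρ Π) ∂ⱼ Tr (ρ Π) / Tr (ρ Π)` of the operator `Π` to the classical
Fisher information matrix (meaningful where the probability does not vanish). -/
noncomputable def cfi {ι H : Type*} [DecidableEq ι] [NormedAddCommGroup H]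
    [InnerProductSpace ℂ H] [CompleteSpace H] (ρ : (ι → ℝ) → H →L[ℂ] H) (P : H →L[ℂ] H)
    (v : ι → ℝ) (i j : ι) : ℝ :=
  pderiv i (prob ρ P) v * pderiv j (prob ρ P) v / prob ρ P v

/-- `L` is a symmetric logarithmic derivative of `ρ` at `v` with respect to the `i`-th
parameter: it is self-adjoint and `(L ρ + ρ L) / 2 = ∂ᵢ ρ`. -/
structure IsSLD {ι H : Type*} [DecidableEq ι] [NormedAddCommGroup H]
    [InnerProductSpace ℂ H] [CompleteSpace H] (ρ : (ι → ℝ) → H →L[ℂ] H) (v : ι → ℝ) (i : ι)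
    (L : H →L[ℂ] H) : Prop where
  selfAdjoint : IsSelfAdjoint L
  eq_pderiv : (1 / 2 : ℂ) • (L * ρ v + ρ v * L) = pderiv i ρ v

/-- The contribution `Re Tr (ρ Lᵢ Π Lⱼ)` of `Π` to the quantum Fisher information matrix. -/
noncomputable def qfi {ι H : Type*} [NormedAddCommGroup H] [InnerProductSpace ℂ H]
    [CompleteSpace H] (ρ : (ι → ℝ) → H →L[ℂ] H) (v : ι → ℝ) (L : ι → H →L[ℂ] H)
    (P : H →L[ℂ] H) (i j : ι) : ℝ :=
  (trace (ρ v * L i * P * L j)).re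

/-- The quantum (Helstrom) Fisher information matrix `Re Tr (ρ Lᵢ Lⱼ)`. -/
noncomputable def helstrom {ι H : Type*} [NormedAddCommGroup H] [InnerProductSpace ℂ H]
    [CompleteSpace H] (ρ : (ι → ℝ) → H →L[ℂ] H) (v : ι → ℝ) (L : ι → H →L[ℂ] H)
    (i j : ι) : ℝ :=
  (trace (ρ v * L i * L j)).re

/-- `T_pq = ½ ∂_p ∂_q Tr (ρ Π)`. At a null operator the probability and its first derivatives
vanish, and `∑ T_pq δ_p δ_q` is the leading term of the probability in the direction `δ`. -/
noncomputable def secondCoeff {ι H : Type*} [DecidableEq ι] [NormedAddCommGroup H]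
    [InnerProductSpace ℂ H] [CompleteSpace H] (ρ : (ι → ℝ) → H →L[ℂ] H) (P : H →L[ℂ] H)
    (v : ι → ℝ) (p q : ι) : ℝ :=
  (1 / 2) * pderiv p (pderiv q (prob ρ P)) v

/-- The matrix bound of the classical Fisher information matrix (CFIM) due to `Π` is saturated
at `v`, i.e. the CFIM contribution of `Π` equals its quantum counterpart.

For a regular operator this is a plain equality. For a null operator the CFIM contribution is
`0 / 0` at `v` and is read as the limit of its values at `v + t δ`, `t → 0`: equality is required
for every direction `δ` in which the leading term of the probability does not vanish. If the
leading term vanishes identically, the multivariate limit (over the points at which the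
probability is nonzero) is used instead. -/
def BoundSaturated {ι H : Type*} [Fintype ι] [DecidableEq ι] [NormedAddCommGroup H]
    [InnerProductSpace ℂ H] [CompleteSpace H] (ρ : (ι → ℝ) → H →L[ℂ] H) (v : ι → ℝ)
    (L : ι → H →L[ℂ] H) (P : H →L[ℂ] H) : Prop :=
  (¬ IsNull ρ P v → ∀ i j, cfi ρ P v i j = qfi ρ v L P i j) ∧
  (IsNull ρ P v →
    (∀ δ : ι → ℝ, ∑ p, ∑ q, secondCoeff ρ P v p q * δ p * δ q ≠ 0 →
      ∀ i j, Tendsto (fun t : ℝ => cfi ρ P (v + t • δ) i j) (𝓝[≠] 0)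
        (𝓝 (qfi ρ v L P i j))) ∧
    ((∀ p q, secondCoeff ρ P v p q = 0) →
      ∀ i j, Tendsto (fun w => cfi ρ P w i j) (𝓝[{w | prob ρ P w ≠ 0}] v)
        (𝓝 (qfi ρ v L P i j))))

/-- `P = ∑_α |π_α⟩⟨π_α|` (strongly convergent) with orthonormal vectors `π_α`. -/
def IsProjectorSum {A H : Type*} [NormedAddCommGroup H] [InnerProductSpace ℂ H]
    (P : H →L[ℂ] H) (π : A → H) : Prop :=
  Orthonormal ℂ π ∧ ∀ x : H, HasSum (fun α => InnerProductSpace.rankOne ℂ (π α) (π α) x) (P x)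

/-- A projective measurement all of whose matrix bounds are saturated at `v`. -/
structure IsOptimalMeasurement {κ ι H : Type*} [Fintype κ] [Fintype ι] [DecidableEq ι]
    [NormedAddCommGroup H] [InnerProductSpace ℂ H] [CompleteSpace H]
    (ρ : (ι → ℝ) → H →L[ℂ] H) (v : ι → ℝ) (L : ι → H →L[ℂ] H) (P : κ → H →L[ℂ] H) : Prop where
  projector : ∀ κ₀, IsStarProjection (P κ₀)
  sum_eq_one : ∑ κ₀, P κ₀ = 1
  saturated : ∀ κ₀, BoundSaturated ρ v L (P κ₀)

end General

end QuantumEstimation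

/-! ## Two incoherent point sources -/

namespace TwoSources

open QuantumEstimation

/-- The pupil plane. -/
abbrev Plane : Type := EuclideanSpace ℝ (Fin 2)

/-- The one photon Hilbert space `L²(ℝ²; ℂ)`. -/
abbrev Photon : Type := Lp ℂ 2 (volume : Measure Plane)

theorem memLp_disc (a C : ℝ) (f : Plane → ℂ) (hf : Measurable f)
    (hC : ∀ r, ‖r‖ ≤ a → ‖f r‖ ≤ C) :
    MemLp ((Metric.closedBall (0 : Plane) a).indicator f) 2 volume := by
  rw [memLp_indicator_iff_restrict Metric.isClosed_closedBall.measurableSet]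
  have : IsFiniteMeasure ((volume : Measure Plane).restrict (Metric.closedBall 0 a)) :=
    ⟨by
      rw [Measure.restrict_apply_univ]
      exact measure_closedBall_lt_top⟩
  refine MemLp.of_bound hf.aestronglyMeasurable C ?_
  filter_upwards [ae_restrict_mem Metric.isClosed_closedBall.measurableSet] with r hr
  exact hC r (by simpa using hr)

/-- The pupil function `Φ_s(r) = 𝒜 circ(r/a) exp[i k (s_⊥ · r - s₃ r² / 2)]`, with
`𝒜 = 1 / (√π a)`; `circ` restricts to the disc of radius `a`. -/
noncomputable def pupilFun (k a : ℝ) (s : Fin 3 → ℝ) : Plane → ℂ :=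
  (Metric.closedBall (0 : Plane) a).indicator fun r =>
    ((1 / (√Real.pi * a) : ℝ) : ℂ) *
      Complex.exp (Complex.I * ((k * (s 0 * r 0 + s 1 * r 1 - s 2 * ‖r‖ ^ 2 / 2) : ℝ) : ℂ))

theorem memLp_pupilFun (k a : ℝ) (s : Fin 3 → ℝ) : MemLp (pupilFun k a s) 2 volume := by
  refine memLp_disc a |1 / (√Real.pi * a)| _ (Continuous.measurable (by fun_prop)) fun r _ => ?_
  rw [norm_mul, Complex.norm_real, Real.norm_eq_abs, mul_comm Complex.I,
    Complex.norm_exp_ofReal_mul_I, mul_one]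

/-- The state `|Φ_s⟩`. -/
noncomputable def pupil (k a : ℝ) (s : Fin 3 → ℝ) : Photon := (memLp_pupilFun k a s).toLp

/-- `θ` is an admissible choice of the overall phase `θ_s`: it is odd and makes
`Δ_s = e^{2 i θ_s} ∫ Φ_s²` real. -/
structure IsPhase (k a : ℝ) (θ : (Fin 3 → ℝ) → ℝ) : Prop where
  odd : ∀ s, θ (-s) = -θ s
  real : ∀ s, (Complex.exp (2 * Complex.I * (θ s : ℂ)) * ∫ r, pupilFun k a s r ^ 2).im = 0

/-- `|Ψ_s⟩ = e^{i θ_s} |Φ_s⟩`. -/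
noncomputable def source (k a : ℝ) (θ : (Fin 3 → ℝ) → ℝ) (s : Fin 3 → ℝ) : Photon :=
  Complex.exp (Complex.I * (θ s : ℂ)) • pupil k a s

/-- The unnormalized eigenvectors `ψ̃₁ = Ψ_s + Ψ_{-s}` and `ψ̃₂ = -i (Ψ_s - Ψ_{-s})` of the one
photon state (indexed by `0` and `1`). -/
noncomputable def psiTilde (k a : ℝ) (θ : (Fin 3 → ℝ) → ℝ) (n : Fin 2) (s : Fin 3 → ℝ) : Photon :=
  ![source k a θ s + source k a θ (-s),
    (-Complex.I) • (source k a θ s - source k a θ (-s))] n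

/-- The one photon mixed state `ρ_s = ½ |Φ_s⟩⟨Φ_s| + ½ |Φ_{-s}⟩⟨Φ_{-s}|`. -/
noncomputable def state (k a : ℝ) (s : Fin 3 → ℝ) : Photon →L[ℂ] Photon :=
  (1 / 2 : ℂ) • InnerProductSpace.rankOne ℂ (pupil k a s) (pupil k a s) +
    (1 / 2 : ℂ) • InnerProductSpace.rankOne ℂ (pupil k a (-s)) (pupil k a (-s))

/-- The phases drop out of the state: `ρ_s = ½ |Ψ_s⟩⟨Ψ_s| + ½ |Ψ_{-s}⟩⟨Ψ_{-s}|`. -/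
theorem state_eq_source (k a : ℝ) (θ : (Fin 3 → ℝ) → ℝ) (s : Fin 3 → ℝ) :
    state k a s =
      (1 / 2 : ℂ) • InnerProductSpace.rankOne ℂ (source k a θ s) (source k a θ s) +
        (1 / 2 : ℂ) • InnerProductSpace.rankOne ℂ (source k a θ (-s)) (source k a θ (-s)) := by
  have key : ∀ s', InnerProductSpace.rankOne ℂ (source k a θ s') (source k a θ s') =
      InnerProductSpace.rankOne ℂ (pupil k a s') (pupil k a s') := by
    intro s'
    have h : Complex.exp (Complex.I * (θ s' : ℂ)) *
        (starRingEnd ℂ) (Complex.exp (Complex.I * (θ s' : ℂ))) = 1 := by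
      rw [← Complex.exp_conj, ← Complex.exp_add]
      simp
    ext1 x
    simp only [source, InnerProductSpace.rankOne_apply, inner_smul_left, smul_smul]
    rw [mul_comm, ← mul_assoc, h, one_mul]
  rw [key, key, state]

/-- The separation `(v₁, v₂, s₃)`; the transverse part `v` is the parameter to be estimated. -/
def sep (s₃ : ℝ) (v : Fin 2 → ℝ) : Fin 3 → ℝ := ![v 0, v 1, s₃]

/-- The radial polynomial `R_n^m(ρ) = ∑_j (-1)^j (n-j)! / (j! ((n+m)/2-j)! ((n-m)/2-j)!) ρ^{n-2j}`
for `m ≤ n` with `n - m` even. -/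
noncomputable def zernikeRadial (n m : ℕ) (ρ : ℝ) : ℝ :=
  ∑ j ∈ Finset.range ((n - m) / 2 + 1),
    (-1) ^ j * ((n - j).factorial : ℝ) /
      ((j.factorial : ℝ) * (((n + m) / 2 - j).factorial : ℝ) * (((n - m) / 2 - j).factorial : ℝ)) *
      ρ ^ (n - 2 * j)

/-- The angular factor: `cos (m φ)` for `m ≥ 0`, and `sin (|m| φ)` for `m < 0`. -/
noncomputable def zernikeAngular (m : ℤ) (φ : ℝ) : ℝ :=
  if 0 ≤ m then Real.cos (m.natAbs * φ) else Real.sin (m.natAbs * φ)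

/-- The normalized real Zernike function `Z_n^m` on the disc of radius `a`, extended by zero. -/
noncomputable def zernikeFun (a : ℝ) (n : ℕ) (m : ℤ) : Plane → ℂ :=
  (Metric.closedBall (0 : Plane) a).indicator fun r =>
    ((√((if m = 0 then 1 else 2) * (n + 1)) / (√Real.pi * a) *
      zernikeRadial n m.natAbs (‖r‖ / a) * zernikeAngular m (Complex.arg ⟨r 0, r 1⟩) : ℝ) : ℂ)

theorem memLp_zernikeFun (a : ℝ) (n : ℕ) (m : ℤ) : MemLp (zernikeFun a n m) 2 volume := by
  have hR : Continuous (zernikeRadial n m.natAbs) := by unfold zernikeRadial; fun_prop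
  have hA : Continuous (zernikeAngular m) := by unfold zernikeAngular; split_ifs <;> fun_prop
  have hA1 : ∀ φ, |zernikeAngular m φ| ≤ 1 := fun φ => by
    unfold zernikeAngular
    split_ifs
    · exact Real.abs_cos_le_one _
    · exact Real.abs_sin_le_one _
  have harg : Measurable fun r : Plane => Complex.arg ⟨r 0, r 1⟩ := by
    refine Complex.measurable_arg.comp ?_
    have : (fun r : Plane => (⟨r 0, r 1⟩ : ℂ)) = fun r => (r 0 : ℂ) + (r 1 : ℂ) * Complex.I := by
      funext r
      apply Complex.ext <;> simp
    rw [this]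
    exact Continuous.measurable (by fun_prop)
  have hc : Continuous fun r : Plane => zernikeRadial n m.natAbs (‖r‖ / a) := by fun_prop
  obtain ⟨C, hC⟩ := (isCompact_closedBall (0 : Plane) a).exists_bound_of_continuousOn
    hc.continuousOn
  refine memLp_disc a (|√((if m = 0 then 1 else 2) * (n + 1)) / (√Real.pi * a)| * C) _ ?_ ?_
  · exact Complex.measurable_ofReal.comp
      ((hc.measurable.const_mul _).mul (hA.measurable.comp harg))
  · intro r hr
    have h1 := hC r (by simpa using hr)
    rw [Complex.norm_real, norm_mul, norm_mul, Real.norm_eq_abs]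
    calc _ ≤ |√((if m = 0 then 1 else 2) * (n + 1)) / (√Real.pi * a)| * C * 1 := by
          refine mul_le_mul (mul_le_mul_of_nonneg_left h1 (abs_nonneg _)) (hA1 _)
            (norm_nonneg _) ?_
          exact mul_nonneg (abs_nonneg _) ((norm_nonneg _).trans h1)
      _ = _ := mul_one _

/-- The Zernike vector `|Z_n^m⟩`. -/
noncomputable def zernike (a : ℝ) (n : ℕ) (m : ℤ) : Photon := (memLp_zernikeFun a n m).toLp

end TwoSources

/-!
The state is an equal mixture of two pure states, the pupil functions `u(v)` and `w(v)` of the two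
sources, and `w` is `u` with the wave number reversed. On the line `s_⊥ = 0` both are radial, while
their derivatives `∂ᵢu = i k xᵢ u` and `∂ᵢw = -i k xᵢ w` are odd, hence orthogonal to `u` and `w`;
and `u`, `w` are linearly independent because `s₃ ≠ 0`. Under these conditions
(`IncoherentPair`) the equation of the symmetric logarithmic derivative, restricted to the span of
`u` and `w`, has only the zero solution, so every solution acts by `Lᵢ u = 2 ∂ᵢu`, `Lᵢ w = 2 ∂ᵢw`
(`apply_of_sld_eq`), and the operator built from the dual basis of `u`, `w` is one
(`exists_selfAdjoint_apply`).

For a projector `P` let `a(v) = (P u(v), P w(v))`, a vector of the real Hilbert space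
`RealPair H`, and `eᵢ = ∂ᵢa(0)`. The probability is `‖a‖² / 2`, its classical Fisher information is
`2 ⟨a, ∂ᵢa⟩ ⟨a, ∂ⱼa⟩ / ‖a‖²`, and the quantum contribution is `2 ⟨eᵢ, eⱼ⟩`
(`IncoherentPair.qfi_eq`). If `a(0) ≠ 0`, the equality case of the Cauchy-Schwarz inequality says
that the two agree iff every `eᵢ` is a real multiple of `a(0)`. If `a(0) = 0`, the limit along `δ`
replaces `a` by `∑ δᵢ eᵢ`, and the two agree in all directions iff the `eᵢ` are pairwise parallel;
if all `eᵢ` vanish, both sides are `0` by the Cauchy-Schwarz inequality.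

To pass from `u`, `w` to the vectors `ψ̃ₙ` one needs that the phase `θ` has vanishing derivative on
the line. The integral `∫ Φ_s²` is even in `s_⊥`, so `θ(v)` and `θ(-v)` agree for small `v` wherever
it does not vanish; it may vanish at the point itself, but not identically near it, since it and
its second derivative are not both zero there (`frequently_integral_pupilFun_sq_ne_zero`).

Finally `Z_{2n+1}^{±1}` is `xᵢ` times a polynomial in `r²`. These are orthonormal
(`integral_zernikePoly_mul`, from a finite difference identity), orthogonal to radial functions, and
their closed span contains `xᵢ exp(ζ r²)` (`discVec_exp_mem_closure`). So `P₂` and `P₃` annihilate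
`u` and `w` and fix the derivatives in one coordinate while annihilating the other, and `P₁`
fixes `u` and `w` and annihilates all derivatives; the saturation criteria hold trivially.
-/

set_option linter.unusedSectionVars false

namespace QuantumEstimation

/-! ### Amplitudes with values in a real inner product space -/

section Amplitude

variable {ι : Type*} [Fintype ι] [DecidableEq ι]

/-- `f` is differentiable everywhere, with partial derivatives `f' i`. -/
def HasPartials {E : Type*} [NormedAddCommGroup E] [NormedSpace ℝ E]
    (f : (ι → ℝ) → E) (f' : ι → (ι → ℝ) → E) : Prop :=
  ∀ v, HasFDerivAt f
    (∑ i, (ContinuousLinearMap.proj i : (ι → ℝ) →L[ℝ] ℝ).smulRight (f' i v)) v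

section Normed

variable {E F : Type*} [NormedAddCommGroup E] [NormedSpace ℝ E] [NormedAddCommGroup F]
  [NormedSpace ℝ F] {f : (ι → ℝ) → E} {f' : ι → (ι → ℝ) → E}

theorem HasPartials.continuous (h : HasPartials f f') : Continuous f :=
  continuous_iff_continuousAt.2 fun v => (h v).continuousAt

theorem sum_smulRight_single (x : ι → E) (i : ι) :
    (∑ j, (ContinuousLinearMap.proj j : (ι → ℝ) →L[ℝ] ℝ).smulRight (x j)) (Pi.single i 1)
      = x i := by
  rw [sum_apply, Finset.sum_eq_single i]
  · simp
  · intro j _ hj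
    simp [Pi.single_eq_of_ne hj]
  · simp

theorem HasPartials.clm_comp (h : HasPartials f f') (T : E →L[ℝ] F) :
    HasPartials (fun v => T (f v)) (fun i v => T (f' i v)) := by
  intro v
  refine (T.hasFDerivAt.comp v (h v)).congr_fderiv ?_
  ext x
  simp

theorem HasPartials.tendsto_div (h : HasPartials f f') (h0 : f 0 = 0) (δ : ι → ℝ) :
    Tendsto (fun t : ℝ => t⁻¹ • f (t • δ)) (𝓝[≠] 0) (𝓝 (∑ i, δ i • f' i 0)) := by
  have := ((h 0).hasLineDerivAt δ)
  rw [HasLineDerivAt, hasDerivAt_iff_tendsto_slope_zero] at this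
  simpa [h0] using this

end Normed

variable {K : Type*} [NormedAddCommGroup K] [InnerProductSpace ℝ K]
  {a : (ι → ℝ) → K} {a' : ι → (ι → ℝ) → K}

theorem HasPartials.pderiv_half_norm_sq (h : HasPartials a a') (i : ι) (v : ι → ℝ) :
    pderiv i (fun v => 1 / 2 * ‖a v‖ ^ 2) v = inner ℝ (a v) (a' i v) := by
  have h1 := ((h v).norm_sq).const_mul (1 / 2 : ℝ)
  rw [pderiv, (h1.hasLineDerivAt _).lineDeriv]
  simp only [smul_apply, ContinuousLinearMap.comp_apply, innerSL_apply_apply,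
    sum_smulRight_single]
  simp

theorem HasPartials.pderiv_pderiv_half_norm_sq (h : HasPartials a a')
    (hc : ∀ i, Continuous (a' i)) (h0 : a 0 = 0) (p q : ι) :
    pderiv p (pderiv q (fun v => 1 / 2 * ‖a v‖ ^ 2)) 0 = inner ℝ (a' p 0) (a' q 0) := by
  have e : pderiv q (fun v => 1 / 2 * ‖a v‖ ^ 2) = fun v => inner ℝ (a v) (a' q v) :=
    funext fun v => h.pderiv_half_norm_sq q v
  rw [e, pderiv]
  refine HasLineDerivAt.lineDeriv ?_
  rw [HasLineDerivAt, hasDerivAt_iff_tendsto_slope_zero]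
  have h1 := h.tendsto_div h0 (Pi.single p 1)
  have h2 : Tendsto (fun t : ℝ => a' q (t • (Pi.single p 1 : ι → ℝ))) (𝓝[≠] 0)
      (𝓝 (a' q 0)) := by
    have : Continuous fun t : ℝ => a' q (t • (Pi.single p 1 : ι → ℝ)) :=
      (hc q).comp (by fun_prop)
    have h3 := this.tendsto 0
    simp only [zero_smul] at h3
    exact h3.mono_left nhdsWithin_le_nhds
  have h3 := h1.inner (𝕜 := ℝ) h2
  have h4 : ∑ i, (Pi.single p 1 : ι → ℝ) i • a' i 0 = a' p 0 := by
    rw [Finset.sum_eq_single p]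
    · simp
    · intro j _ hj
      simp [Pi.single_eq_of_ne hj]
    · simp
  rw [h4] at h3
  refine h3.congr fun t => ?_
  simp [h0, real_inner_smul_left]

/-- The classical Fisher information of the probability `‖a‖² / 2` of an amplitude `a` whose
partial derivatives are `e`. -/
noncomputable def amplitudeFisher (a : K) (e : ι → K) (i j : ι) : ℝ :=
  2 * (inner ℝ a (e i) * inner ℝ a (e j)) / ‖a‖ ^ 2

theorem HasPartials.fisher_eq (h : HasPartials a a') (v : ι → ℝ) (i j : ι) :
    pderiv i (fun v => 1 / 2 * ‖a v‖ ^ 2) v * pderiv j (fun v => 1 / 2 * ‖a v‖ ^ 2) v /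
      (1 / 2 * ‖a v‖ ^ 2) = amplitudeFisher (a v) (fun i => a' i v) i j := by
  rw [h.pderiv_half_norm_sq, h.pderiv_half_norm_sq, amplitudeFisher]
  field_simp

theorem amplitudeFisher_smul {c : ℝ} (hc : c ≠ 0) (a : K) (e : ι → K) (i j : ι) :
    amplitudeFisher (c • a) e i j = amplitudeFisher a e i j := by
  simp only [amplitudeFisher, real_inner_smul_left, norm_smul, mul_pow, Real.norm_eq_abs, sq_abs]
  rw [show 2 * (c * inner ℝ a (e i) * (c * inner ℝ a (e j)))
    = c ^ 2 * (2 * (inner ℝ a (e i) * inner ℝ a (e j))) by ring]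
  exact mul_div_mul_left _ _ (pow_ne_zero 2 hc)

theorem tendsto_amplitudeFisher {X : Type*} {l : Filter X} {b : X → K} {e : X → ι → K} {b₀ : K}
    {e₀ : ι → K} (hb : Tendsto b l (𝓝 b₀)) (he : ∀ i, Tendsto (fun x => e x i) l (𝓝 (e₀ i)))
    (h0 : b₀ ≠ 0) (i j : ι) :
    Tendsto (fun x => amplitudeFisher (b x) (e x) i j) l (𝓝 (amplitudeFisher b₀ e₀ i j)) := by
  unfold amplitudeFisher
  refine Tendsto.div ?_ (hb.norm.pow 2) (by simpa using h0)
  exact ((hb.inner (he i)).mul (hb.inner (he j))).const_mul 2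

/-- The `0 / 0` limit of the Fisher information in a direction in which the amplitude has a
nonvanishing derivative. -/
theorem HasPartials.tendsto_fisher_line (h : HasPartials a a') (hc : ∀ i, Continuous (a' i))
    (h0 : a 0 = 0) (δ : ι → ℝ) (hδ : ∑ i, δ i • a' i 0 ≠ 0) (i j : ι) :
    Tendsto (fun t : ℝ => amplitudeFisher (a (t • δ)) (fun i => a' i (t • δ)) i j) (𝓝[≠] 0)
      (𝓝 (amplitudeFisher (∑ i, δ i • a' i 0) (fun i => a' i 0) i j)) := by
  have h2 : ∀ i, Tendsto (fun t : ℝ => a' i (t • δ)) (𝓝[≠] 0) (𝓝 (a' i 0)) := by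
    intro i
    have : Continuous fun t : ℝ => a' i (t • δ) := (hc i).comp (by fun_prop)
    have h3 := this.tendsto 0
    simp only [zero_smul] at h3
    exact h3.mono_left nhdsWithin_le_nhds
  refine (tendsto_amplitudeFisher (h.tendsto_div h0 δ) h2 hδ i j).congr' ?_
  filter_upwards [self_mem_nhdsWithin] with t ht
  exact amplitudeFisher_smul (inv_ne_zero ht) _ _ _ _

/-- By the Cauchy-Schwarz inequality the Fisher information is controlled by the derivatives of
the amplitude. -/
theorem abs_amplitudeFisher_le (a : K) (e : ι → K) (i j : ι) :
    |amplitudeFisher a e i j| ≤ 2 * (‖e i‖ * ‖e j‖) := by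
  rcases eq_or_ne a 0 with rfl | ha
  · simp only [amplitudeFisher, inner_zero_left, mul_zero, zero_div, abs_zero]
    positivity
  · have hpos : 0 < ‖a‖ ^ 2 := by positivity
    rw [amplitudeFisher, abs_div, abs_of_pos hpos, div_le_iff₀ hpos, abs_mul, abs_mul, abs_two]
    have h1 := abs_real_inner_le_norm a (e i)
    have h2 := abs_real_inner_le_norm a (e j)
    calc 2 * (|inner ℝ a (e i)| * |inner ℝ a (e j)|)
        ≤ 2 * ((‖a‖ * ‖e i‖) * (‖a‖ * ‖e j‖)) := by gcongr
      _ = _ := by ring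

theorem tendsto_amplitudeFisher_zero (hc : ∀ i, Continuous (a' i)) (h0 : ∀ i, a' i 0 = 0)
    (i j : ι) :
    Tendsto (fun v => amplitudeFisher (a v) (fun i => a' i v) i j) (𝓝 0) (𝓝 0) := by
  have h1 : Tendsto (fun v => 2 * (‖a' i v‖ * ‖a' j v‖)) (𝓝 0) (𝓝 0) := by
    have : Continuous fun v => 2 * (‖a' i v‖ * ‖a' j v‖) :=
      continuous_const.mul ((hc i).norm.mul (hc j).norm)
    have h2 := this.tendsto 0
    simpa [h0] using h2
  refine squeeze_zero_norm (fun v => ?_) h1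
  exact abs_amplitudeFisher_le _ _ _ _

/-- The equality case of the Cauchy-Schwarz inequality. -/
theorem eq_smul_of_inner_sq_eq {x y : K} (hx : x ≠ 0)
    (h : inner ℝ x y * inner ℝ x y / ‖x‖ ^ 2 = inner ℝ y y) :
    y = (inner ℝ x y / ‖x‖ ^ 2) • x := by
  have hx2 : ‖x‖ ^ 2 ≠ 0 := by positivity
  rw [← sub_eq_zero, ← inner_self_eq_zero (𝕜 := ℝ)]
  simp only [inner_sub_left, inner_sub_right, real_inner_smul_left, real_inner_smul_right,
    real_inner_self_eq_norm_sq x, ← h, real_inner_comm x y]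
  field_simp
  ring

theorem amplitudeFisher_of_eq_smul {a : K} (ha : a ≠ 0) {e : ι → K} {ξ : ι → ℝ}
    (h : ∀ i, e i = ξ i • a) (i j : ι) :
    amplitudeFisher a e i j = 2 * inner ℝ (e i) (e j) := by
  have hx2 : ‖a‖ ^ 2 ≠ 0 := by positivity
  simp only [amplitudeFisher, h, real_inner_smul_left, real_inner_smul_right,
    real_inner_self_eq_norm_sq]
  field_simp

theorem amplitudeFisher_eq_iff {a : K} (ha : a ≠ 0) (e : ι → K) :
    (∀ i j, amplitudeFisher a e i j = 2 * inner ℝ (e i) (e j)) ↔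
      ∃ ξ : ι → ℝ, ∀ i, e i = ξ i • a := by
  constructor
  · intro h
    refine ⟨fun i => inner ℝ a (e i) / ‖a‖ ^ 2, fun i => eq_smul_of_inner_sq_eq ha ?_⟩
    have := h i i
    rw [amplitudeFisher] at this
    linear_combination this / 2
  · rintro ⟨ξ, h⟩ i j
    exact amplitudeFisher_of_eq_smul ha h i j

/-- For a null amplitude all directional limits of the Fisher information agree with the quantum
one exactly when the derivatives of the amplitude are pairwise parallel. -/
theorem amplitudeFisher_directional_iff (e : ι → K) :
    (∀ δ : ι → ℝ, ∑ i, δ i • e i ≠ 0 →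
      ∀ i j, amplitudeFisher (∑ i, δ i • e i) e i j = 2 * inner ℝ (e i) (e j)) ↔
    ∀ i j, (∃ η : ℝ, e i = η • e j) ∨ (∃ η : ℝ, e j = η • e i) := by
  constructor
  · intro h i j
    rcases eq_or_ne (e i) 0 with h0 | h0
    · exact Or.inl ⟨0, by simp [h0]⟩
    · right
      have hs : ∑ l, (Pi.single i 1 : ι → ℝ) l • e l = e i := by
        rw [Finset.sum_eq_single i]
        · simp
        · intro j _ hj
          simp [Pi.single_eq_of_ne hj]
        · simp
      have h1 := h (Pi.single i 1)
      rw [hs] at h1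
      obtain ⟨ξ, hξ⟩ := (amplitudeFisher_eq_iff h0 e).1 (h1 h0)
      exact ⟨ξ j, hξ j⟩
  · intro h δ hδ
    obtain ⟨p, hp⟩ : ∃ p, e p ≠ 0 := by
      by_contra! hall
      exact hδ (by simp [hall])
    have hmul : ∀ i, ∃ c : ℝ, e i = c • e p := by
      intro i
      rcases h i p with ⟨η, hη⟩ | ⟨η, hη⟩
      · exact ⟨η, hη⟩
      · have h0 : η ≠ 0 := by
          rintro rfl
          exact hp (by simpa using hη)
        exact ⟨η⁻¹, by rw [hη, smul_smul, inv_mul_cancel₀ h0, one_smul]⟩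
    choose c hc using hmul
    have hs : ∑ i, δ i • e i = (∑ i, δ i * c i) • e p := by
      rw [Finset.sum_smul]
      refine Finset.sum_congr rfl fun i _ => ?_
      rw [mul_smul, ← hc]
    have h0 : ∑ i, δ i * c i ≠ 0 := by
      intro h0
      rw [h0, zero_smul] at hs
      exact hδ hs
    refine fun i j => amplitudeFisher_of_eq_smul hδ (ξ := fun i => c i / ∑ i, δ i * c i) ?_ i j
    intro i
    rw [hs, smul_smul, div_mul_cancel₀ _ h0]
    exact hc i

theorem sum_sum_inner_mul_mul (e : ι → K) (δ : ι → ℝ) :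
    ∑ p, ∑ q, 1 / 2 * inner ℝ (e p) (e q) * δ p * δ q = 1 / 2 * ‖∑ i, δ i • e i‖ ^ 2 := by
  rw [← real_inner_self_eq_norm_sq, sum_inner, Finset.mul_sum]
  refine Finset.sum_congr rfl fun p _ => ?_
  rw [inner_sum, Finset.mul_sum]
  refine Finset.sum_congr rfl fun q _ => ?_
  rw [real_inner_smul_left, real_inner_smul_right]
  ring

end Amplitude

/-! ### Projectors and traces -/

section Projector

variable {H : Type*} [NormedAddCommGroup H] [InnerProductSpace ℂ H]

/-- The (unnormalized) equal mixture of the two pure states `x` and `y`. -/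
noncomputable def mixture (x y : H) : H →L[ℂ] H :=
  (1 / 2 : ℂ) • InnerProductSpace.rankOne ℂ x x + (1 / 2 : ℂ) • InnerProductSpace.rankOne ℂ y y

theorem mixture_apply (x y z : H) :
    mixture x y z = (1 / 2 : ℂ) • inner ℂ x z • x + (1 / 2 : ℂ) • inner ℂ y z • y := by
  simp [mixture, InnerProductSpace.rankOne_apply]

variable [CompleteSpace H]

/-- The probability rule `Tr (ρ A) = (⟨x, A x⟩ + ⟨y, A y⟩) / 2`; the trace is evaluated by
Parseval in the Hilbert basis that defines it. -/
theorem trace_mixture_mul (x y : H) (A : H →L[ℂ] H) :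
    trace (mixture x y * A) = 1 / 2 * inner ℂ x (A x) + 1 / 2 * inner ℂ y (A y) := by
  obtain ⟨b, hb⟩ := (exists_hilbertBasis ℂ H).choose_spec
  have key : ∀ x : H, HasSum (fun e : (exists_hilbertBasis ℂ H).choose =>
      inner ℂ (e : H) (inner ℂ x (A e) • x)) (inner ℂ x (A x)) := by
    intro x
    have h := b.hasSum_inner_mul_inner (A.adjoint x) x
    rw [ContinuousLinearMap.adjoint_inner_left] at h
    refine h.congr_fun fun e => ?_
    have he : b e = (e : H) := congrFun hb e
    rw [he, ContinuousLinearMap.adjoint_inner_left, inner_smul_right]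
  rw [trace, ← (((key x).mul_left (1 / 2)).add ((key y).mul_left (1 / 2))).tsum_eq]
  refine tsum_congr fun e => ?_
  change inner ℂ (e : H) (mixture x y (A e)) = _
  rw [mixture_apply, inner_add_right, inner_smul_right (r := 1 / 2),
    inner_smul_right (r := 1 / 2)]

theorem starProjection_inner_left {P : H →L[ℂ] H} (hP : IsStarProjection P) (x y : H) :
    inner ℂ (P x) y = inner ℂ x (P y) := by
  conv_lhs => rw [← hP.isSelfAdjoint.adjoint_eq]
  exact ContinuousLinearMap.adjoint_inner_left _ _ _

theorem starProjection_apply_apply {P : H →L[ℂ] H} (hP : IsStarProjection P) (x : H) :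
    P (P x) = P x :=
  DFunLike.congr_fun hP.isIdempotentElem.eq x

theorem inner_starProjection_right {P : H →L[ℂ] H} (hP : IsStarProjection P) (x y : H) :
    inner ℂ x (P y) = inner ℂ (P x) (P y) := by
  rw [starProjection_inner_left hP, starProjection_apply_apply hP]

variable {A : Type*} {P : H →L[ℂ] H} {π : A → H}

theorem IsProjectorSum.apply_basis (h : IsProjectorSum P π) (α : A) : P (π α) = π α := by
  classical
  refine (h.2 (π α)).unique ?_
  refine (hasSum_ite_eq α (π α)).congr_fun fun β => ?_
  rw [InnerProductSpace.rankOne_apply, orthonormal_iff_ite.1 h.1 β α]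
  split_ifs with hβ
  · simp [hβ]
  · simp

theorem IsProjectorSum.isStarProjection (h : IsProjectorSum P π) : IsStarProjection P := by
  constructor
  · refine ContinuousLinearMap.ext fun x => ?_
    refine (((h.2 x).mapL P).congr_fun fun α => ?_).unique (h.2 x)
    rw [InnerProductSpace.rankOne_apply, map_smul, h.apply_basis]
  · rw [ContinuousLinearMap.isSelfAdjoint_iff_isSymmetric]
    intro x y
    have h1 := (h.2 x).mapL (innerSL ℂ y)
    have h2 := (h.2 y).mapL (innerSL ℂ x)
    simp only [innerSL_apply_apply, InnerProductSpace.rankOne_apply, inner_smul_right] at h1 h2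
    have h3 := h1.star
    have e := (h2.congr_fun fun α => ?_).unique h3
    · rw [RCLike.star_def, inner_conj_symm] at e
      exact e.symm
    · simp only [star_mul', RCLike.star_def, inner_conj_symm]
      ring

theorem IsProjectorSum.inner_apply (h : IsProjectorSum P π) (α : A) (x : H) :
    inner ℂ (π α) (P x) = inner ℂ (π α) x := by
  rw [← starProjection_inner_left h.isStarProjection, h.apply_basis]

/-- A vector is annihilated by the projector iff it is orthogonal to all the `π α`. -/
theorem IsProjectorSum.apply_eq_zero_iff (h : IsProjectorSum P π) (x : H) :
    P x = 0 ↔ ∀ α, inner ℂ (π α) x = 0 := by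
  constructor
  · intro h0 α
    rw [← h.inner_apply, h0, inner_zero_right]
  · intro h0
    refine (h.2 x).unique ?_
    simp only [InnerProductSpace.rankOne_apply, h0, zero_smul]
    exact hasSum_zero

theorem IsProjectorSum.apply_eq_smul_iff (h : IsProjectorSum P π) (c : ℝ) (x y : H) :
    P x = (c : ℂ) • P y ↔ ∀ α, inner ℂ x (π α) = (c : ℂ) * inner ℂ y (π α) := by
  have h1 : P x = (c : ℂ) • P y ↔ P (x - (c : ℂ) • y) = 0 := by
    rw [map_sub, map_smul, sub_eq_zero]
  rw [h1, h.apply_eq_zero_iff]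
  refine forall_congr' fun α => ?_
  rw [← inner_conj_symm, map_eq_zero, inner_sub_left, inner_smul_left, Complex.conj_ofReal,
    sub_eq_zero]

/-- Every vector in the closed span of the `π α` is fixed by the projector. -/
theorem IsProjectorSum.apply_eq_self (h : IsProjectorSum P π) {x : H}
    (hx : x ∈ (Submodule.span ℂ (Set.range π)).topologicalClosure) : P x = x := by
  have hcl : IsClosed {x : H | P x = x} := isClosed_eq P.continuous continuous_id
  have hspan : (Submodule.span ℂ (Set.range π) : Set H) ⊆ {x : H | P x = x} := by
    intro y hy
    refine Submodule.span_induction (p := fun y _ => P y = y) ?_ ?_ ?_ ?_ hy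
    · rintro _ ⟨α, rfl⟩
      exact h.apply_basis α
    · exact map_zero P
    · intro y z _ _ hy hz
      rw [map_add, hy, hz]
    · intro c y _ hy
      rw [map_smul, hy]
  exact closure_minimal hspan hcl hx

/-- The projector onto the closed span of an orthonormal family. -/
theorem exists_isProjectorSum (hπ : Orthonormal ℂ π) :
    ∃ P : H →L[ℂ] H, IsProjectorSum P π := by
  set U := (Submodule.span ℂ (Set.range π)).topologicalClosure with hU
  have hmem : ∀ α, π α ∈ U := fun α =>
    Submodule.le_topologicalClosure _ (Submodule.subset_span ⟨α, rfl⟩)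
  have hUc : IsClosed (U : Set H) := Submodule.isClosed_topologicalClosure _
  have : CompleteSpace U := hUc.completeSpace_coe
  have ho : Orthonormal ℂ (fun α => (⟨π α, hmem α⟩ : U)) := by
    classical
    rw [orthonormal_iff_ite] at hπ ⊢
    exact hπ
  have hbot : (Submodule.span ℂ (Set.range fun α => (⟨π α, hmem α⟩ : U)))ᗮ = ⊥ := by
    rw [eq_bot_iff]
    intro x hx
    have h1 : (x : H) ∈ (Submodule.span ℂ (Set.range π))ᗮ := by
      rw [Submodule.mem_orthogonal] at hx ⊢
      intro y hy
      refine Submodule.span_induction (p := fun y _ => inner ℂ y (x : H) = 0) ?_ ?_ ?_ ?_ hy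
      · rintro _ ⟨α, rfl⟩
        exact hx ⟨π α, hmem α⟩ (Submodule.subset_span ⟨α, rfl⟩)
      · simp
      · intro y z _ _ hy hz
        rw [inner_add_left, hy, hz, add_zero]
      · intro c y _ hy
        rw [inner_smul_left, hy, mul_zero]
    rw [← Submodule.orthogonal_closure] at h1
    have h2 := (Submodule.mem_orthogonal _ _).1 h1 x x.2
    rw [inner_self_eq_zero] at h2
    simpa using h2
  let b := HilbertBasis.mkOfOrthogonalEqBot ho hbot
  refine ⟨U.subtypeL ∘L U.orthogonalProjectionOnto, hπ, fun x => ?_⟩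
  have h1 := (b.hasSum_orthogonalProjectionOnto x).mapL U.subtypeL
  refine h1.congr_fun fun α => ?_
  simp [b, InnerProductSpace.rankOne_apply]

end Projector

/-! ### Symmetric logarithmic derivatives of an equal mixture of two pure states -/

section Mixture

variable {H : Type*} [NormedAddCommGroup H] [InnerProductSpace ℂ H]

theorem one_sub_inner_mul_inner_ne_zero {x y : H} (h : ‖inner ℂ y x‖ < 1) :
    1 - inner ℂ x y * inner ℂ y x ≠ 0 := by
  intro h0
  have h1 : inner ℂ x y * inner ℂ y x = 1 := (sub_eq_zero.1 h0).symm
  have h2 := congrArg norm h1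
  rw [norm_mul, norm_inner_symm x y, norm_one] at h2
  nlinarith [norm_nonneg (inner ℂ y x)]

variable [CompleteSpace H]

/-- A self-adjoint operator with `L x = 2 x'` and `L y = 2 y'` solves the equation of the symmetric
logarithmic derivative of `mixture x y` in the direction `(x', y')`. -/
theorem sld_eq_of_apply {x y x' y' : H} {L : H →L[ℂ] H} (hL : IsSelfAdjoint L)
    (hx : L x = (2 : ℂ) • x') (hy : L y = (2 : ℂ) • y') :
    (1 / 2 : ℂ) • (L * mixture x y + mixture x y * L) =
      (1 / 2 : ℂ) • (InnerProductSpace.rankOne ℂ x' x + InnerProductSpace.rankOne ℂ x x') +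
      (1 / 2 : ℂ) • (InnerProductSpace.rankOne ℂ y' y + InnerProductSpace.rankOne ℂ y y') := by
  have hsymm := ContinuousLinearMap.isSelfAdjoint_iff_isSymmetric.1 hL
  refine ContinuousLinearMap.ext fun z => ?_
  have h1 : inner ℂ x (L z) = 2 * inner ℂ x' z := by
    have := hsymm x z
    simp only [ContinuousLinearMap.coe_coe, hx, inner_smul_left, map_ofNat] at this
    exact this.symm
  have h2 : inner ℂ y (L z) = 2 * inner ℂ y' z := by
    have := hsymm y z
    simp only [ContinuousLinearMap.coe_coe, hy, inner_smul_left, map_ofNat] at this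
    exact this.symm
  change (1 / 2 : ℂ) • (L (mixture x y z) + mixture x y (L z)) =
    (1 / 2 : ℂ) • (inner ℂ x z • x' + inner ℂ x' z • x) +
    (1 / 2 : ℂ) • (inner ℂ y z • y' + inner ℂ y' z • y)
  simp only [mixture_apply, map_add, map_smul, hx, hy, h1, h2]
  module

/-- Existence of a symmetric logarithmic derivative, built from the basis dual to `x`, `y`. -/
theorem exists_selfAdjoint_apply {x y x' y' : H} (nx : ‖x‖ = 1) (ny : ‖y‖ = 1)
    (hxy : ‖inner ℂ y x‖ < 1) (h1 : inner ℂ x x' = 0) (h2 : inner ℂ y x' = 0)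
    (h3 : inner ℂ x y' = 0) (h4 : inner ℂ y y' = 0) :
    ∃ L : H →L[ℂ] H, IsSelfAdjoint L ∧ L x = (2 : ℂ) • x' ∧ L y = (2 : ℂ) • y' := by
  have hd := one_sub_inner_mul_inner_ne_zero hxy
  set d : ℂ := 1 - inner ℂ x y * inner ℂ y x with hd'
  have hdc : (starRingEnd ℂ) d = d := by
    simp only [hd', map_sub, map_one, map_mul, inner_conj_symm]
    ring
  have hxx : inner ℂ x x = 1 := by rw [inner_self_eq_norm_sq_to_K, nx]; simp
  have hyy : inner ℂ y y = 1 := by rw [inner_self_eq_norm_sq_to_K, ny]; simp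
  have h1' : inner ℂ x' x = 0 := inner_eq_zero_symm.1 h1
  have h2' : inner ℂ x' y = 0 := inner_eq_zero_symm.1 h2
  have h3' : inner ℂ y' x = 0 := inner_eq_zero_symm.1 h3
  have h4' : inner ℂ y' y = 0 := inner_eq_zero_symm.1 h4
  set p : H := d⁻¹ • (x - inner ℂ y x • y) with hp
  set q : H := d⁻¹ • (y - inner ℂ x y • x) with hq
  have hpx : inner ℂ p x = 1 := by
    rw [hp, inner_smul_left, inner_sub_left, inner_smul_left, hxx, map_inv₀, hdc, inner_conj_symm,
      ← hd', inv_mul_cancel₀ hd]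
  have hpy : inner ℂ p y = 0 := by
    rw [hp, inner_smul_left, inner_sub_left, inner_smul_left, hyy, inner_conj_symm]
    ring
  have hqy : inner ℂ q y = 1 := by
    rw [hq, inner_smul_left, inner_sub_left, inner_smul_left, hyy, map_inv₀, hdc, inner_conj_symm,
      mul_comm (inner ℂ y x), ← hd', inv_mul_cancel₀ hd]
  have hqx : inner ℂ q x = 0 := by
    rw [hq, inner_smul_left, inner_sub_left, inner_smul_left, hxx, inner_conj_symm]
    ring
  have hsa : ∀ a b : H, IsSelfAdjoint
      (InnerProductSpace.rankOne ℂ a b + InnerProductSpace.rankOne ℂ b a : H →L[ℂ] H) := by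
    intro a b
    rw [isSelfAdjoint_iff, star_add, ContinuousLinearMap.star_eq_adjoint,
      ContinuousLinearMap.star_eq_adjoint, InnerProductSpace.adjoint_rankOne,
      InnerProductSpace.adjoint_rankOne, add_comm]
  refine ⟨(2 : ℂ) • ((InnerProductSpace.rankOne ℂ x' p + InnerProductSpace.rankOne ℂ p x') +
    (InnerProductSpace.rankOne ℂ y' q + InnerProductSpace.rankOne ℂ q y')), ?_, ?_, ?_⟩
  · refine IsSelfAdjoint.smul ?_ ((hsa _ _).add (hsa _ _))
    rw [isSelfAdjoint_iff]
    simp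
  · change (2 : ℂ) • ((inner ℂ p x • x' + inner ℂ x' x • p) +
      (inner ℂ q x • y' + inner ℂ y' x • q)) = _
    simp [hpx, h1', hqx, h3']
  · change (2 : ℂ) • ((inner ℂ p y • x' + inner ℂ x' y • p) +
      (inner ℂ q y • y' + inner ℂ y' y • q)) = _
    simp [hpy, h2', hqy, h4']

/-- Every symmetric logarithmic derivative acts on the two states as twice the derivative, if the
derivatives are orthogonal to the states. With the matrix `m` of `L` on the span of `x` and `y` and
their Gram matrix `G` the equation reads `m G + G m = 0` there, which forces `m = 0`. -/
theorem apply_of_sld_eq {x y x' y' : H} {L : H →L[ℂ] H} (nx : ‖x‖ = 1) (ny : ‖y‖ = 1)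
    (hxy : ‖inner ℂ y x‖ < 1) (h1 : inner ℂ x x' = 0) (h2 : inner ℂ y x' = 0)
    (h3 : inner ℂ x y' = 0) (h4 : inner ℂ y y' = 0)
    (h : (1 / 2 : ℂ) • (L * mixture x y + mixture x y * L) =
      (1 / 2 : ℂ) • (InnerProductSpace.rankOne ℂ x' x + InnerProductSpace.rankOne ℂ x x') +
      (1 / 2 : ℂ) • (InnerProductSpace.rankOne ℂ y' y + InnerProductSpace.rankOne ℂ y y')) :
    L x = (2 : ℂ) • x' ∧ L y = (2 : ℂ) • y' := by
  have hd := one_sub_inner_mul_inner_ne_zero hxy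
  have hxx : inner ℂ x x = 1 := by rw [inner_self_eq_norm_sq_to_K, nx]; simp
  have hyy : inner ℂ y y = 1 := by rw [inner_self_eq_norm_sq_to_K, ny]; simp
  have h1' : inner ℂ x' x = 0 := inner_eq_zero_symm.1 h1
  have h2' : inner ℂ x' y = 0 := inner_eq_zero_symm.1 h2
  have h3' : inner ℂ y' x = 0 := inner_eq_zero_symm.1 h3
  have h4' : inner ℂ y' y = 0 := inner_eq_zero_symm.1 h4
  have heq : ∀ z, (1 / 2 : ℂ) • (L (mixture x y z) + mixture x y (L z)) =
      (1 / 2 : ℂ) • (inner ℂ x z • x' + inner ℂ x' z • x) +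
      (1 / 2 : ℂ) • (inner ℂ y z • y' + inner ℂ y' z • y) := fun z => DFunLike.congr_fun h z
  have ex := heq x
  have ey := heq y
  simp only [mixture_apply, map_add, map_smul, hxx, hyy, h1', h2', h3', h4'] at ex ey
  have exx := congrArg (inner ℂ x) ex
  have eyx := congrArg (inner ℂ y) ex
  have exy := congrArg (inner ℂ x) ey
  have eyy := congrArg (inner ℂ y) ey
  simp only [inner_add_right, inner_smul_right, hxx, hyy, h1, h2, h3, h4] at exx eyx exy eyy
  set c := inner ℂ y x
  set c' := inner ℂ x y
  set m₁ := inner ℂ x (L x)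
  set m₂ := inner ℂ y (L y)
  set n₁ := inner ℂ x (L y)
  set n₂ := inner ℂ y (L x)
  have e1 : m₁ = m₂ := by linear_combination 2 * exx - 2 * eyy
  have e2 : n₂ = -c * m₁ := by linear_combination 2 * eyx + c / 2 * e1
  have e3 : n₁ = -c' * m₁ := by linear_combination 2 * exy + c' / 2 * e1
  have e4 : m₁ = 0 := by
    refine (mul_eq_zero.1 (?_ : (1 - c' * c) * m₁ = 0)).resolve_left hd
    linear_combination 2 * exx - c / 2 * e3 - c' / 2 * e2
  rw [e4, mul_zero] at e2 e3
  rw [e4] at e1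
  simp only [e4, ← e1, e2, e3] at ex ey
  constructor
  · refine sub_eq_zero.1 ((smul_eq_zero.1 (?_ : (1 - c' * c) • (L x - (2 : ℂ) • x') = 0))
      |>.resolve_left hd)
    linear_combination (norm := module) (4 : ℂ) • ex - (4 * c : ℂ) • ey
  · refine sub_eq_zero.1 ((smul_eq_zero.1 (?_ : (1 - c' * c) • (L y - (2 : ℂ) • y') = 0))
      |>.resolve_left hd)
    linear_combination (norm := module) (4 : ℂ) • ey - (4 * c' : ℂ) • ex

end Mixture

/-! ### Saturation for two incoherent states -/

section Pair

/-- `H × H` with the real part of its Hilbert space inner product. -/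
def RealPair (H : Type*) : Type _ := WithLp 2 (H × H)

variable {H : Type*} [NormedAddCommGroup H] [InnerProductSpace ℂ H]

noncomputable instance : NormedAddCommGroup (RealPair H) :=
  inferInstanceAs (NormedAddCommGroup (WithLp 2 (H × H)))

noncomputable instance : InnerProductSpace ℝ (RealPair H) :=
  InnerProductSpace.rclikeToReal ℂ (WithLp 2 (H × H))

/-- The vector of `RealPair H` with components `x` and `y`. -/
def RealPair.mk (x y : H) : RealPair H := WithLp.toLp 2 (x, y)

theorem RealPair.inner_mk (x y x' y' : H) :
    inner ℝ (RealPair.mk x y) (RealPair.mk x' y') = (inner ℂ x x' + inner ℂ y y').re := by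
  rw [← WithLp.prod_inner_apply (WithLp.toLp 2 (x, y)) (WithLp.toLp 2 (x', y'))]
  rfl

theorem RealPair.norm_mk_sq (x y : H) : ‖RealPair.mk x y‖ ^ 2 = ‖x‖ ^ 2 + ‖y‖ ^ 2 := by
  rw [← real_inner_self_eq_norm_sq, RealPair.inner_mk, inner_self_eq_norm_sq_to_K,
    inner_self_eq_norm_sq_to_K]
  norm_cast

theorem RealPair.mk_eq_zero (x y : H) : RealPair.mk x y = 0 ↔ x = 0 ∧ y = 0 := by
  constructor
  · intro h
    have h1 := congrArg (fun z : WithLp 2 (H × H) => z.fst) h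
    have h2 := congrArg (fun z : WithLp 2 (H × H) => z.snd) h
    exact ⟨h1, h2⟩
  · rintro ⟨rfl, rfl⟩
    rfl

theorem RealPair.mk_eq_smul (x y x' y' : H) (c : ℝ) :
    RealPair.mk x y = c • RealPair.mk x' y' ↔ x = (c : ℂ) • x' ∧ y = (c : ℂ) • y' := by
  constructor
  · intro h
    have h1 := congrArg (fun z : WithLp 2 (H × H) => z.fst) h
    have h2 := congrArg (fun z : WithLp 2 (H × H) => z.snd) h
    exact ⟨h1, h2⟩
  · rintro ⟨rfl, rfl⟩
    rfl

/-- `(x, y) ↦ (P x, P y)` as a real linear map into `RealPair H`. -/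
noncomputable def RealPair.map (P : H →L[ℂ] H) : H × H →L[ℝ] RealPair H where
  toFun z := RealPair.mk (P z.1) (P z.2)
  map_add' x y := by
    rw [Prod.fst_add, Prod.snd_add, map_add, map_add]
    rfl
  map_smul' c x := by
    rw [RingHom.id_apply, RealPair.mk_eq_smul, Prod.smul_fst, Prod.smul_snd]
    rw [← algebraMap_smul ℂ c x.1, ← algebraMap_smul ℂ c x.2, map_smul, map_smul]
    exact ⟨rfl, rfl⟩
  cont := by
    have h : Continuous fun z : H × H => (WithLp.toLp 2 (P z.1, P z.2) : WithLp 2 (H × H)) := by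
      fun_prop
    exact h

end Pair

section Saturation

variable {ι : Type*} [Fintype ι] [DecidableEq ι]
  {H : Type*} [NormedAddCommGroup H] [InnerProductSpace ℂ H]

/-- Two continuously differentiable families of states (with partial derivatives `u'`, `w'`), which
are normalized and linearly independent at the parameter `0`, the derivatives being orthogonal to
both states there. -/
structure IncoherentPair (u w : (ι → ℝ) → H) (u' w' : ι → (ι → ℝ) → H) : Prop where
  hasPartials_left : HasPartials u u'
  hasPartials_right : HasPartials w w'
  continuous_left : ∀ i, Continuous (u' i)
  continuous_right : ∀ i, Continuous (w' i)
  norm_left : ‖u 0‖ = 1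
  norm_right : ‖w 0‖ = 1
  norm_inner_lt_one : ‖inner ℂ (w 0) (u 0)‖ < 1
  inner_left_left : ∀ i, inner ℂ (u 0) (u' i 0) = 0
  inner_right_left : ∀ i, inner ℂ (w 0) (u' i 0) = 0
  inner_left_right : ∀ i, inner ℂ (u 0) (w' i 0) = 0
  inner_right_right : ∀ i, inner ℂ (w 0) (w' i 0) = 0

variable {u w : (ι → ℝ) → H} {u' w' : ι → (ι → ℝ) → H}

theorem continuous_rankOne :
    Continuous fun z : H × H => (InnerProductSpace.rankOne ℂ z.1 z.2 : H →L[ℂ] H) := by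
  have h := (ContinuousLinearMap.smulRightL ℂ H H).continuous₂
  exact h.comp (((innerSL ℂ).continuous.comp continuous_snd).prodMk continuous_fst)

theorem real_smul_rankOne (r : ℝ) (x y : H) :
    r • InnerProductSpace.rankOne ℂ x y = (InnerProductSpace.rankOne ℂ (r • x) y : H →L[ℂ] H) := by
  refine ContinuousLinearMap.ext fun z => ?_
  change (r : ℂ) • (inner ℂ y z • x) = inner ℂ y z • r • x
  rw [smul_comm, ← algebraMap_smul ℂ r x]
  rfl

theorem rankOne_real_smul (r : ℝ) (x y : H) :
    (InnerProductSpace.rankOne ℂ x (r • y) : H →L[ℂ] H) = r • InnerProductSpace.rankOne ℂ x y := by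
  refine ContinuousLinearMap.ext fun z => ?_
  change inner ℂ (r • y) z • x = (r : ℂ) • (inner ℂ y z • x)
  rw [← algebraMap_smul ℂ r y, inner_smul_left, smul_smul]
  simp

theorem HasPartials.hasLineDerivAt (h : HasPartials u u') (i : ι) (v : ι → ℝ) :
    HasLineDerivAt ℝ u (u' i v) v (Pi.single i 1) := by
  have := (h v).hasLineDerivAt (Pi.single i 1)
  rwa [sum_smulRight_single] at this

theorem HasPartials.hasLineDerivAt_rankOne (h : HasPartials u u') (i : ι) (v : ι → ℝ) :
    HasLineDerivAt ℝ (fun v => (InnerProductSpace.rankOne ℂ (u v) (u v) : H →L[ℂ] H))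
      (InnerProductSpace.rankOne ℂ (u' i v) (u v) + InnerProductSpace.rankOne ℂ (u v) (u' i v))
      v (Pi.single i 1) := by
  have h1 := h.hasLineDerivAt i v
  rw [HasLineDerivAt, hasDerivAt_iff_tendsto_slope_zero] at h1 ⊢
  have h2 : Tendsto (fun t : ℝ => u (v + t • (Pi.single i 1 : ι → ℝ))) (𝓝[≠] 0) (𝓝 (u v)) := by
    have : Continuous fun t : ℝ => u (v + t • (Pi.single i 1 : ι → ℝ)) :=
      h.continuous.comp (by fun_prop)
    have h3 := this.tendsto 0
    simp only [zero_smul, add_zero] at h3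
    exact h3.mono_left nhdsWithin_le_nhds
  have hc := continuous_rankOne (H := H)
  have h3 := (hc.tendsto _).comp (h1.prodMk_nhds h2)
  have h4 := (hc.tendsto _).comp ((tendsto_const_nhds (x := u v)).prodMk_nhds h1)
  refine (h3.add h4).congr fun t => ?_
  simp only [Function.comp_apply, zero_smul, add_zero]
  rw [← real_smul_rankOne, rankOne_real_smul, ← smul_add]
  simp

theorem IncoherentPair.pderiv_mixture (h : IncoherentPair u w u' w') (i : ι) (v : ι → ℝ) :
    pderiv i (fun v => mixture (u v) (w v)) v =
      (1 / 2 : ℂ) • (InnerProductSpace.rankOne ℂ (u' i v) (u v) +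
        InnerProductSpace.rankOne ℂ (u v) (u' i v)) +
      (1 / 2 : ℂ) • (InnerProductSpace.rankOne ℂ (w' i v) (w v) +
        InnerProductSpace.rankOne ℂ (w v) (w' i v)) := by
  have h1 := h.hasPartials_left.hasLineDerivAt_rankOne i v
  have h2 := h.hasPartials_right.hasLineDerivAt_rankOne i v
  rw [pderiv]
  refine HasLineDerivAt.lineDeriv ?_
  rw [HasLineDerivAt] at h1 h2 ⊢
  exact (h1.const_smul (1 / 2 : ℂ)).add (h2.const_smul (1 / 2 : ℂ))

variable [CompleteSpace H]

theorem IncoherentPair.exists_sld (h : IncoherentPair u w u' w') (i : ι) :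
    ∃ L : H →L[ℂ] H, IsSLD (fun v => mixture (u v) (w v)) 0 i L := by
  obtain ⟨L, hL, h1, h2⟩ := exists_selfAdjoint_apply h.norm_left h.norm_right h.norm_inner_lt_one
    (h.inner_left_left i) (h.inner_right_left i) (h.inner_left_right i) (h.inner_right_right i)
  exact ⟨L, hL, by rw [h.pderiv_mixture]; exact sld_eq_of_apply hL h1 h2⟩

/-- Every symmetric logarithmic derivative doubles the derivatives of the two states. -/
theorem IncoherentPair.sld_apply (h : IncoherentPair u w u' w') {i : ι} {L : H →L[ℂ] H}
    (hL : IsSLD (fun v => mixture (u v) (w v)) 0 i L) :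
    L (u 0) = (2 : ℂ) • u' i 0 ∧ L (w 0) = (2 : ℂ) • w' i 0 := by
  have h1 := hL.eq_pderiv
  rw [h.pderiv_mixture] at h1
  exact apply_of_sld_eq h.norm_left h.norm_right h.norm_inner_lt_one
    (h.inner_left_left i) (h.inner_right_left i) (h.inner_left_right i) (h.inner_right_right i) h1

/-- The amplitude `(P u, P w)`: half its squared norm is the probability of the outcome `P`. -/
noncomputable def amplitude (P : H →L[ℂ] H) (u w : (ι → ℝ) → H) (v : ι → ℝ) : RealPair H :=
  RealPair.mk (P (u v)) (P (w v))

theorem IncoherentPair.hasPartials_amplitude (h : IncoherentPair u w u' w') (P : H →L[ℂ] H) :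
    HasPartials (amplitude P u w) (fun i => amplitude P (u' i) (w' i)) := by
  have h1 : HasPartials (fun v => (u v, w v)) (fun i v => (u' i v, w' i v)) := by
    intro v
    refine ((h.hasPartials_left v).prodMk (h.hasPartials_right v)).congr_fderiv ?_
    ext x <;> simp [Prod.fst_sum, Prod.snd_sum]
  exact h1.clm_comp (RealPair.map P)

theorem IncoherentPair.continuous_amplitude (h : IncoherentPair u w u' w') (P : H →L[ℂ] H)
    (i : ι) : Continuous (amplitude P (u' i) (w' i)) :=
  (RealPair.map P).continuous.comp ((h.continuous_left i).prodMk (h.continuous_right i))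

variable {P : H →L[ℂ] H}

theorem trace_mixture_mul_starProjection (hP : IsStarProjection P) (v : ι → ℝ) :
    trace (mixture (u v) (w v) * P) = ((1 / 2 * ‖amplitude P u w v‖ ^ 2 : ℝ) : ℂ) := by
  rw [trace_mixture_mul, inner_starProjection_right hP (u v), inner_starProjection_right hP (w v),
    amplitude, RealPair.norm_mk_sq, inner_self_eq_norm_sq_to_K, inner_self_eq_norm_sq_to_K,
    mul_add]
  push_cast
  rfl

theorem prob_mixture (hP : IsStarProjection P) :
    prob (fun v => mixture (u v) (w v)) P = fun v => 1 / 2 * ‖amplitude P u w v‖ ^ 2 := by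
  funext v
  rw [prob, trace_mixture_mul_starProjection hP, Complex.ofReal_re]

theorem isNull_mixture_iff (hP : IsStarProjection P) (v : ι → ℝ) :
    IsNull (fun v => mixture (u v) (w v)) P v ↔ amplitude P u w v = 0 := by
  rw [IsNull, trace_mixture_mul_starProjection hP, Complex.ofReal_eq_zero]
  simp

theorem IncoherentPair.cfi_eq (h : IncoherentPair u w u' w') (hP : IsStarProjection P)
    (v : ι → ℝ) (i j : ι) :
    cfi (fun v => mixture (u v) (w v)) P v i j =
      amplitudeFisher (amplitude P u w v) (fun i => amplitude P (u' i) (w' i) v) i j := by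
  rw [← (h.hasPartials_amplitude P).fisher_eq, cfi, prob_mixture hP]

theorem IncoherentPair.qfi_eq (h : IncoherentPair u w u' w') (hP : IsStarProjection P) {L : ι → H →L[ℂ] H}
    (hL : ∀ i, IsSLD (fun v => mixture (u v) (w v)) 0 i (L i)) (i j : ι) :
    qfi (fun v => mixture (u v) (w v)) 0 L P i j =
      2 * inner ℝ (amplitude P (u' i) (w' i) 0) (amplitude P (u' j) (w' j) 0) := by
  have hsymm := ContinuousLinearMap.isSelfAdjoint_iff_isSymmetric.1 (hL i).selfAdjoint
  have key : ∀ x y : H, inner ℂ x (L i (P (L j y))) = inner ℂ (P (L i x)) (P (L j y)) := by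
    intro x y
    have := hsymm x (P (L j y))
    simp only [ContinuousLinearMap.coe_coe] at this
    rw [← this, inner_starProjection_right hP]
  rw [qfi, mul_assoc, mul_assoc, trace_mixture_mul]
  change (1 / 2 * inner ℂ (u 0) (L i (P (L j (u 0)))) +
    1 / 2 * inner ℂ (w 0) (L i (P (L j (w 0))))).re = _
  rw [key, key, (h.sld_apply (hL i)).1, (h.sld_apply (hL i)).2, (h.sld_apply (hL j)).1,
    (h.sld_apply (hL j)).2, amplitude, amplitude, RealPair.inner_mk]
  simp only [map_smul, inner_smul_left, inner_smul_right, map_ofNat]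
  rw [← Complex.re_ofReal_mul]
  congr 1
  push_cast
  ring

/-- A regular projector saturates its bound iff the derivatives of its amplitude are real multiples
of the amplitude. -/
theorem IncoherentPair.boundSaturated_regular_iff (h : IncoherentPair u w u' w')
    (hP : IsStarProjection P) {L : ι → H →L[ℂ] H}
    (hL : ∀ i, IsSLD (fun v => mixture (u v) (w v)) 0 i (L i))
    (hn : ¬ IsNull (fun v => mixture (u v) (w v)) P 0) :
    BoundSaturated (fun v => mixture (u v) (w v)) 0 L P ↔
      ∃ ξ : ι → ℝ, ∀ i, P (u' i 0) = (ξ i : ℂ) • P (u 0) ∧ P (w' i 0) = (ξ i : ℂ) • P (w 0) := by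
  have h0 : amplitude P u w 0 ≠ 0 := fun h0 => hn ((isNull_mixture_iff hP 0).2 h0)
  have h1 := amplitudeFisher_eq_iff h0 (fun i => amplitude P (u' i) (w' i) 0)
  simp only [BoundSaturated, hn, not_false_iff, forall_const, false_imp_iff, and_true,
    h.cfi_eq hP, h.qfi_eq hP hL, h1]
  simp only [amplitude, RealPair.mk_eq_smul]

theorem IncoherentPair.secondCoeff_eq (h : IncoherentPair u w u' w') (hP : IsStarProjection P)
    (h0 : amplitude P u w 0 = 0) (p q : ι) :
    secondCoeff (fun v => mixture (u v) (w v)) P 0 p q =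
      1 / 2 * inner ℝ (amplitude P (u' p) (w' p) 0) (amplitude P (u' q) (w' q) 0) := by
  rw [secondCoeff, prob_mixture hP,
    (h.hasPartials_amplitude P).pderiv_pderiv_half_norm_sq (h.continuous_amplitude P) h0]

theorem IncoherentPair.sum_secondCoeff_ne_zero_iff (h : IncoherentPair u w u' w')
    (hP : IsStarProjection P) (h0 : amplitude P u w 0 = 0) (δ : ι → ℝ) :
    ∑ p, ∑ q, secondCoeff (fun v => mixture (u v) (w v)) P 0 p q * δ p * δ q ≠ 0 ↔
      ∑ i, δ i • amplitude P (u' i) (w' i) 0 ≠ 0 := by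
  simp only [h.secondCoeff_eq hP h0, sum_sum_inner_mul_mul]
  simp

theorem IncoherentPair.tendsto_cfi_null (h : IncoherentPair u w u' w') (hP : IsStarProjection P)
    (h0 : amplitude P u w 0 = 0) (δ : ι → ℝ)
    (hδ : ∑ i, δ i • amplitude P (u' i) (w' i) 0 ≠ 0) (i j : ι) :
    Tendsto (fun t : ℝ => cfi (fun v => mixture (u v) (w v)) P (t • δ) i j) (𝓝[≠] 0)
      (𝓝 (amplitudeFisher (∑ i, δ i • amplitude P (u' i) (w' i) 0)
        (fun i => amplitude P (u' i) (w' i) 0) i j)) := by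
  simp only [h.cfi_eq hP]
  exact (h.hasPartials_amplitude P).tendsto_fisher_line (h.continuous_amplitude P) h0 δ hδ i j

/-- A null projector saturates its bound iff the derivatives of its amplitude are pairwise
parallel. -/
theorem IncoherentPair.boundSaturated_null_iff (h : IncoherentPair u w u' w')
    (hP : IsStarProjection P) {L : ι → H →L[ℂ] H}
    (hL : ∀ i, IsSLD (fun v => mixture (u v) (w v)) 0 i (L i))
    (hn : IsNull (fun v => mixture (u v) (w v)) P 0) :
    BoundSaturated (fun v => mixture (u v) (w v)) 0 L P ↔
      ∀ i j, (∃ η : ℝ, P (u' i 0) = (η : ℂ) • P (u' j 0) ∧ P (w' i 0) = (η : ℂ) • P (w' j 0)) ∨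
        (∃ η : ℝ, P (u' j 0) = (η : ℂ) • P (u' i 0) ∧ P (w' j 0) = (η : ℂ) • P (w' i 0)) := by
  have h0 := (isNull_mixture_iff hP 0).1 hn
  simp only [← RealPair.mk_eq_smul]
  change _ ↔ ∀ i j, (∃ η : ℝ, amplitude P (u' i) (w' i) 0 = η • amplitude P (u' j) (w' j) 0) ∨
    (∃ η : ℝ, amplitude P (u' j) (w' j) 0 = η • amplitude P (u' i) (w' i) 0)
  rw [← amplitudeFisher_directional_iff (fun i => amplitude P (u' i) (w' i) 0)]
  have hT := h.sum_secondCoeff_ne_zero_iff hP h0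
  constructor
  · intro hs δ hδ i j
    have h1 := (hs.2 hn).1 δ ((hT δ).2 hδ) i j
    simp only [zero_add] at h1
    rw [← h.qfi_eq hP hL]
    exact tendsto_nhds_unique (h.tendsto_cfi_null hP h0 δ hδ i j) h1
  · intro hs
    refine ⟨fun hn' => absurd hn hn', fun _ => ⟨fun δ hδ i j => ?_, fun hT0 i j => ?_⟩⟩
    · rw [hT] at hδ
      simp only [zero_add]
      rw [h.qfi_eq hP hL, ← hs δ hδ i j]
      exact h.tendsto_cfi_null hP h0 δ hδ i j
    · have hz : ∀ i, amplitude P (u' i) (w' i) 0 = 0 := by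
        intro i
        have := hT0 i i
        rw [h.secondCoeff_eq hP h0, real_inner_self_eq_norm_sq] at this
        simpa using this
      simp only [h.cfi_eq hP, h.qfi_eq hP hL, hz, inner_zero_left, mul_zero]
      exact (tendsto_amplitudeFisher_zero (h.continuous_amplitude P) hz i j).mono_left
        nhdsWithin_le_nhds

theorem IncoherentPair.tendsto_cfi_of_saturated_null (h : IncoherentPair u w u' w')
    (hP : IsStarProjection P) {L : ι → H →L[ℂ] H}
    (hn : IsNull (fun v => mixture (u v) (w v)) P 0)
    (hs : BoundSaturated (fun v => mixture (u v) (w v)) 0 L P) {δ : ι → ℝ}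
    (hδ : ∑ i, δ i • amplitude P (u' i) (w' i) 0 ≠ 0) (i j : ι) :
    Tendsto (fun t : ℝ => cfi (fun v => mixture (u v) (w v)) P (t • δ) i j) (𝓝[≠] 0)
      (𝓝 (qfi (fun v => mixture (u v) (w v)) 0 L P i j)) := by
  have h0 := (isNull_mixture_iff hP 0).1 hn
  have h1 := (hs.2 hn).1 δ ((h.sum_secondCoeff_ne_zero_iff hP h0 δ).2 hδ) i j
  simpa only [zero_add] using h1

theorem IncoherentPair.tendsto_cfi_regular (h : IncoherentPair u w u' w')
    (hP : IsStarProjection P) {L : ι → H →L[ℂ] H}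
    (hn : ¬ IsNull (fun v => mixture (u v) (w v)) P 0)
    (hs : BoundSaturated (fun v => mixture (u v) (w v)) 0 L P) (δ : ι → ℝ) (i j : ι) :
    Tendsto (fun t : ℝ => cfi (fun v => mixture (u v) (w v)) P (t • δ) i j) (𝓝[≠] 0)
      (𝓝 (qfi (fun v => mixture (u v) (w v)) 0 L P i j)) := by
  rw [← hs.1 hn i j]
  simp only [h.cfi_eq hP]
  have hline : Tendsto (fun t : ℝ => t • δ) (𝓝[≠] 0) (𝓝 0) := by
    have : Continuous fun t : ℝ => t • δ := by fun_prop
    have h3 := this.tendsto 0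
    rw [zero_smul] at h3
    exact h3.mono_left nhdsWithin_le_nhds
  refine tendsto_amplitudeFisher ?_ (fun i => ?_) ?_ i j
  · exact ((h.hasPartials_amplitude P).continuous.tendsto 0).comp hline
  · exact ((h.continuous_amplitude P i).tendsto 0).comp hline
  · exact fun h0 => hn ((isNull_mixture_iff hP 0).2 h0)

/-- The quantum contributions of a three outcome measurement add up to the Helstrom matrix. -/
theorem qfi_add_qfi_add_qfi {L : ι → H →L[ℂ] H} {P₁ P₂ P₃ : H →L[ℂ] H} (hsum : P₁ + P₂ + P₃ = 1) (i j : ι) :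
    qfi (fun v => mixture (u v) (w v)) 0 L P₁ i j + qfi (fun v => mixture (u v) (w v)) 0 L P₂ i j +
      qfi (fun v => mixture (u v) (w v)) 0 L P₃ i j =
      helstrom (fun v => mixture (u v) (w v)) 0 L i j := by
  have key : ∀ z, L i (P₁ (L j z)) + L i (P₂ (L j z)) + L i (P₃ (L j z)) = L i (L j z) := by
    intro z
    rw [← map_add, ← map_add]
    congr 1
    exact DFunLike.congr_fun hsum (L j z)
  rw [helstrom, qfi, qfi, qfi]
  simp only [mul_assoc]
  simp only [trace_mixture_mul, ← Complex.add_re]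
  congr 1
  change 1 / 2 * inner ℂ (u 0) (L i (P₁ (L j (u 0)))) + 1 / 2 * inner ℂ (w 0) (L i (P₁ (L j (w 0))))
    + (1 / 2 * inner ℂ (u 0) (L i (P₂ (L j (u 0)))) + 1 / 2 * inner ℂ (w 0) (L i (P₂ (L j (w 0)))))
    + (1 / 2 * inner ℂ (u 0) (L i (P₃ (L j (u 0)))) + 1 / 2 * inner ℂ (w 0) (L i (P₃ (L j (w 0)))))
    = 1 / 2 * inner ℂ (u 0) (L i (L j (u 0))) + 1 / 2 * inner ℂ (w 0) (L i (L j (w 0)))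
  rw [← key, ← key]
  simp only [inner_add_right]
  ring

end Saturation
end QuantumEstimation

namespace TwoSources
open QuantumEstimation

/-! ### Functions on the disc -/

theorem memLp_indicator_continuousMap (a : ℝ) (f : C(Plane, ℂ)) :
    MemLp ((Metric.closedBall (0 : Plane) a).indicator f) 2 volume := by
  obtain ⟨C, hC⟩ := (isCompact_closedBall (0 : Plane) a).exists_bound_of_continuousOn
    f.continuous.continuousOn
  exact memLp_disc a C f f.continuous.measurable fun r hr => hC r (by simpa using hr)

/-- The restriction of a continuous function to the disc of radius `a`, as a vector of `L²`. -/
noncomputable def discVec (a : ℝ) : C(Plane, ℂ) →ₗ[ℂ] Photon where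
  toFun f := (memLp_indicator_continuousMap a f).toLp
  map_add' f g := by
    rw [← MemLp.toLp_add]
    congr 1
    exact Set.indicator_add _ _ _
  map_smul' c f := by
    rw [RingHom.id_apply, ← MemLp.toLp_const_smul]
    congr 1
    exact Set.indicator_const_smul _ c f

theorem toLp_eq_discVec {a : ℝ} {F : Plane → ℂ} (hF : MemLp F 2 volume) (f : C(Plane, ℂ))
    (h : F = (Metric.closedBall (0 : Plane) a).indicator f) : hF.toLp = discVec a f := by
  subst h
  rfl

theorem inner_discVec (a : ℝ) (f g : C(Plane, ℂ)) :
    inner ℂ (discVec a f) (discVec a g) =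
      ∫ r in Metric.closedBall (0 : Plane) a, (starRingEnd ℂ) (f r) * g r := by
  rw [L2.inner_def, ← integral_indicator Metric.isClosed_closedBall.measurableSet]
  refine integral_congr_ae ?_
  filter_upwards [(memLp_indicator_continuousMap a f).coeFn_toLp,
    (memLp_indicator_continuousMap a g).coeFn_toLp] with r hf hg
  change inner ℂ ((memLp_indicator_continuousMap a f).toLp _ r)
    ((memLp_indicator_continuousMap a g).toLp _ r) = _
  rw [hf, hg]
  by_cases hr : r ∈ Metric.closedBall (0 : Plane) a
  · simp [Set.indicator_of_mem hr, mul_comm]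
  · simp [Set.indicator_of_notMem hr]

theorem volume_real_disc {a : ℝ} (ha : 0 ≤ a) :
    (volume : Measure Plane).real (Metric.closedBall 0 a) = Real.pi * a ^ 2 := by
  rw [Measure.real, EuclideanSpace.volume_closedBall_fin_two]
  rw [ENNReal.toReal_mul, ENNReal.toReal_pow, ENNReal.toReal_ofReal ha]
  simp [mul_comm, Real.pi_pos.le]

theorem norm_discVec_le {a C : ℝ} (ha : 0 ≤ a) (hC : 0 ≤ C) (f : C(Plane, ℂ))
    (h : ∀ r : Plane, ‖r‖ ≤ a → ‖f r‖ ≤ C) : ‖discVec a f‖ ≤ C * (√Real.pi * a) := by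
  have h1 : ‖discVec a f‖ ^ 2 ≤ (C * (√Real.pi * a)) ^ 2 := by
    have h2 : ‖(inner ℂ (discVec a f) (discVec a f) : ℂ)‖ = ‖discVec a f‖ ^ 2 := by
      rw [inner_self_eq_norm_sq_to_K]
      simp
    rw [← h2, inner_discVec]
    calc _ ≤ C ^ 2 * (volume : Measure Plane).real (Metric.closedBall 0 a) := by
          refine norm_setIntegral_le_of_norm_le_const measure_closedBall_lt_top fun r hr => ?_
          have h3 := h r (by simpa using hr)
          rw [norm_mul, RCLike.norm_conj, pow_two]
          gcongr
      _ = _ := by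
          rw [volume_real_disc ha, mul_pow, mul_pow, Real.sq_sqrt Real.pi_pos.le]
  exact (sq_le_sq₀ (norm_nonneg _) (by positivity)).1 h1

/-! ### Integrals over the disc -/

theorem setIntegral_disc_comp (a : ℝ) (R : Plane ≃ₗᵢ[ℝ] Plane) (h : Plane → ℂ) :
    ∫ r in Metric.closedBall (0 : Plane) a, h (R r) = ∫ r in Metric.closedBall (0 : Plane) a, h r := by
  have := R.measurePreserving.setIntegral_preimage_emb R.toHomeomorph.measurableEmbedding h
    (Metric.closedBall (0 : Plane) a)
  rw [← this, R.preimage_closedBall, map_zero]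

theorem setIntegral_disc_eq_zero (a : ℝ) (R : Plane ≃ₗᵢ[ℝ] Plane) (h : Plane → ℂ)
    (hR : ∀ r, h (R r) = -h r) : ∫ r in Metric.closedBall (0 : Plane) a, h r = 0 := by
  have h1 := setIntegral_disc_comp a R h
  simp only [hR, integral_neg] at h1
  linear_combination (-1 / 2 : ℂ) * h1

/-- Integrals of radial functions over the disc. -/
theorem setIntegral_disc_radial {a : ℝ} (ha : 0 ≤ a) (F : ℝ → ℂ) (hF : Continuous F) :
    ∫ r in Metric.closedBall (0 : Plane) a, F (‖r‖ ^ 2) = Real.pi * ∫ t in 0..a ^ 2, F t := by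
  rw [← integral_indicator Metric.isClosed_closedBall.measurableSet]
  have h1 : (Metric.closedBall (0 : Plane) a).indicator (fun r => F (‖r‖ ^ 2)) =
      fun r => (Set.Iic a).indicator (fun y => F (y ^ 2)) ‖r‖ := by
    funext r
    by_cases hr : ‖r‖ ≤ a
    · rw [Set.indicator_of_mem (by simpa using hr), Set.indicator_of_mem (by simpa using hr)]
    · rw [Set.indicator_of_notMem (by simpa using hr), Set.indicator_of_notMem (by simpa using hr)]
  have hball : (volume : Measure Plane).real (Metric.ball 0 1) = Real.pi := by
    rw [Measure.real, EuclideanSpace.volume_ball_fin_two]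
    simp [Real.pi_pos.le]
  rw [h1, integral_fun_norm_addHaar, finrank_euclideanSpace_fin, hball]
  have h2 : (fun y : ℝ => y ^ (2 - 1) • (Set.Iic a).indicator (fun y => F (y ^ 2)) y) =
      (Set.Iic a).indicator (fun y => y • F (y ^ 2)) := by
    funext y
    by_cases hy : y ≤ a
    · rw [Set.indicator_of_mem (by simpa using hy), Set.indicator_of_mem (by simpa using hy)]
      simp
    · rw [Set.indicator_of_notMem (by simpa using hy), Set.indicator_of_notMem (by simpa using hy)]
      simp
  rw [h2, setIntegral_indicator measurableSet_Iic, Set.Ioi_inter_Iic,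
    ← intervalIntegral.integral_of_le ha]
  have h3 : ∫ y in 0..a, (2 * y) • (F ∘ fun y => y ^ 2) y = ∫ t in 0 ^ 2..a ^ 2, F t := by
    refine intervalIntegral.integral_deriv_smul_comp (f := fun y : ℝ => y ^ 2) ?_ ?_ hF
    · intro y _
      simpa using hasDerivAt_pow 2 y
    · fun_prop
  rw [zero_pow two_ne_zero] at h3
  rw [← h3]
  simp only [mul_smul, Function.comp_apply]
  rw [intervalIntegral.integral_smul]
  simp only [nsmul_eq_mul, Complex.real_smul]
  push_cast
  ring

/-- The isometry exchanging the two coordinates. -/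
noncomputable def swapCoord : Plane ≃ₗᵢ[ℝ] Plane :=
  LinearIsometryEquiv.piLpCongrLeft 2 ℝ ℝ (Equiv.swap 0 1)

theorem swapCoord_apply (r : Plane) (i : Fin 2) : swapCoord r i = r (Equiv.swap 0 1 i) := by
  simp [swapCoord, LinearIsometryEquiv.piLpCongrLeft_apply, Equiv.piCongrLeft'_apply]

/-- The isometry changing the sign of the coordinate `i`. -/
noncomputable def flipCoord (i : Fin 2) : Plane ≃ₗᵢ[ℝ] Plane :=
  LinearIsometryEquiv.piLpCongrRight 2 fun j =>
    if j = i then LinearIsometryEquiv.neg ℝ else LinearIsometryEquiv.refl ℝ ℝ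

theorem flipCoord_apply_self (r : Plane) (i : Fin 2) : flipCoord i r i = -r i := by
  simp [flipCoord]

theorem flipCoord_apply_of_ne (r : Plane) {i j : Fin 2} (h : j ≠ i) : flipCoord i r j = r j := by
  simp [flipCoord, h]

theorem setIntegral_disc_coord_sq {a : ℝ} (ha : 0 ≤ a) (F : ℝ → ℂ) (hF : Continuous F)
    (i : Fin 2) :
    ∫ r in Metric.closedBall (0 : Plane) a, (r i : ℂ) ^ 2 * F (‖r‖ ^ 2) =
      Real.pi / 2 * ∫ t in 0..a ^ 2, t * F t := by
  have h01 : ∫ r in Metric.closedBall (0 : Plane) a, (r 0 : ℂ) ^ 2 * F (‖r‖ ^ 2) =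
      ∫ r in Metric.closedBall (0 : Plane) a, (r 1 : ℂ) ^ 2 * F (‖r‖ ^ 2) := by
    rw [← setIntegral_disc_comp a swapCoord]
    simp [swapCoord_apply]
  have hint : ∀ i : Fin 2, IntegrableOn (fun r : Plane => (r i : ℂ) ^ 2 * F (‖r‖ ^ 2))
      (Metric.closedBall 0 a) := fun i =>
    ContinuousOn.integrableOn_compact (isCompact_closedBall _ _)
      (Continuous.continuousOn (by fun_prop))
  have hsum := setIntegral_disc_radial ha (fun t => t * F t) (by fun_prop)
  have h2 : ∫ r in Metric.closedBall (0 : Plane) a, ((‖r‖ ^ 2 : ℝ) : ℂ) * F (‖r‖ ^ 2) =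
      (∫ r in Metric.closedBall (0 : Plane) a, (r 0 : ℂ) ^ 2 * F (‖r‖ ^ 2)) +
      ∫ r in Metric.closedBall (0 : Plane) a, (r 1 : ℂ) ^ 2 * F (‖r‖ ^ 2) := by
    rw [← integral_add (hint 0) (hint 1)]
    congr 1
    funext r
    rw [EuclideanSpace.norm_sq_eq]
    simp
    ring
  rw [h2] at hsum
  fin_cases i
  · change ∫ r in Metric.closedBall (0 : Plane) a, (r 0 : ℂ) ^ 2 * F (‖r‖ ^ 2) = _
    linear_combination hsum / 2 + h01 / 2
  · change ∫ r in Metric.closedBall (0 : Plane) a, (r 1 : ℂ) ^ 2 * F (‖r‖ ^ 2) = _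
    linear_combination hsum / 2 - h01 / 2

/-- The radial function `r ↦ F (‖r‖²)`. -/
noncomputable def rad (F : C(ℝ, ℂ)) : C(Plane, ℂ) := ⟨fun r => F (‖r‖ ^ 2), by fun_prop⟩

/-- The coordinate function `r ↦ r i`. -/
noncomputable def coord (i : Fin 2) : C(Plane, ℂ) := ⟨fun r => (r i : ℂ), by fun_prop⟩

theorem rad_apply (F : C(ℝ, ℂ)) (r : Plane) : rad F r = F (‖r‖ ^ 2) := rfl

theorem coord_apply (i : Fin 2) (r : Plane) : coord i r = (r i : ℂ) := rfl

theorem inner_rad_rad {a : ℝ} (ha : 0 ≤ a) (F G : C(ℝ, ℂ)) :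
    inner ℂ (discVec a (rad F)) (discVec a (rad G)) =
      Real.pi * ∫ t in 0..a ^ 2, (starRingEnd ℂ) (F t) * G t := by
  rw [inner_discVec, ← setIntegral_disc_radial ha _ (by fun_prop)]
  rfl

theorem inner_rad_coord (a : ℝ) (F G : C(ℝ, ℂ)) (i : Fin 2) :
    inner ℂ (discVec a (rad F)) (discVec a (coord i * rad G)) = 0 := by
  rw [inner_discVec]
  refine setIntegral_disc_eq_zero a (LinearIsometryEquiv.neg ℝ) _ fun r => ?_
  simp [rad_apply, coord_apply]

theorem inner_coord_rad (a : ℝ) (F G : C(ℝ, ℂ)) (i : Fin 2) :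
    inner ℂ (discVec a (coord i * rad F)) (discVec a (rad G)) = 0 :=
  inner_eq_zero_symm.1 (inner_rad_coord a G F i)

theorem inner_coord_coord_of_ne (a : ℝ) (F G : C(ℝ, ℂ)) {i j : Fin 2} (h : j ≠ i) :
    inner ℂ (discVec a (coord i * rad F)) (discVec a (coord j * rad G)) = 0 := by
  rw [inner_discVec]
  refine setIntegral_disc_eq_zero a (flipCoord i) _ fun r => ?_
  simp [rad_apply, coord_apply, flipCoord_apply_self, flipCoord_apply_of_ne r h]

theorem inner_coord_coord_self {a : ℝ} (ha : 0 ≤ a) (F G : C(ℝ, ℂ)) (i : Fin 2) :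
    inner ℂ (discVec a (coord i * rad F)) (discVec a (coord i * rad G)) =
      Real.pi / 2 * ∫ t in 0..a ^ 2, t * ((starRingEnd ℂ) (F t) * G t) := by
  rw [inner_discVec, ← setIntegral_disc_coord_sq ha _ (by fun_prop) i]
  congr 1
  funext r
  simp only [ContinuousMap.mul_apply, rad_apply, coord_apply, map_mul, Complex.conj_ofReal]
  ring

/-! ### The pupil function and its derivatives -/

/-- The plane wave `r ↦ exp (i κ (v₁ x₁ + v₂ x₂))`. -/
noncomputable def wave (κ : ℝ) (v : Fin 2 → ℝ) : C(Plane, ℂ) :=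
  ⟨fun r => Complex.exp (Complex.I * ((κ * (v 0 * r 0 + v 1 * r 1) : ℝ) : ℂ)), by fun_prop⟩

theorem wave_apply (κ : ℝ) (v : Fin 2 → ℝ) (r : Plane) :
    wave κ v r = Complex.exp (Complex.I * ((κ * (v 0 * r 0 + v 1 * r 1) : ℝ) : ℂ)) := rfl

theorem wave_zero (κ : ℝ) : wave κ 0 = 1 := by
  ext r
  simp [wave_apply]

theorem norm_wave (κ : ℝ) (v : Fin 2 → ℝ) (r : Plane) : ‖wave κ v r‖ = 1 := by
  rw [wave_apply, mul_comm, Complex.norm_exp_ofReal_mul_I]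

theorem norm_exp_I_mul_sub_one_sub_le (y : ℝ) :
    ‖Complex.exp (Complex.I * y) - 1 - Complex.I * y‖ ≤ 3 * y ^ 2 := by
  have hn : ‖Complex.I * (y : ℂ)‖ = |y| := by simp
  rcases le_or_gt |y| 1 with h | h
  · calc _ ≤ ‖Complex.I * (y : ℂ)‖ ^ 2 := Complex.norm_exp_sub_one_sub_id_le (by rwa [hn])
      _ ≤ 3 * y ^ 2 := by rw [hn, sq_abs]; nlinarith [sq_nonneg y]
  · have h1 : ‖Complex.exp (Complex.I * y)‖ = 1 := by
      rw [mul_comm, Complex.norm_exp_ofReal_mul_I]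
    calc _ ≤ ‖Complex.exp (Complex.I * y) - 1‖ + ‖Complex.I * (y : ℂ)‖ := norm_sub_le _ _
      _ ≤ (‖Complex.exp (Complex.I * y)‖ + ‖(1 : ℂ)‖) + |y| := by
          rw [hn]
          gcongr
          exact norm_sub_le _ _
      _ ≤ 3 * y ^ 2 := by
          rw [h1, norm_one, ← sq_abs]
          nlinarith

/-- Plane waves are differentiable in the wave vector, uniformly on the disc. -/
theorem hasPartials_discVec_mul_wave {a : ℝ} (ha : 0 ≤ a) (κ : ℝ) (f : C(Plane, ℂ)) :
    HasPartials (fun v => discVec a (f * wave κ v))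
      (fun i v => discVec a ((f * ((Complex.I * κ) • coord i)) * wave κ v)) := by
  intro v
  obtain ⟨C, hC⟩ := (isCompact_closedBall (0 : Plane) a).exists_bound_of_continuousOn
    f.continuous.continuousOn
  have hC0 : 0 ≤ C := (norm_nonneg _).trans (hC 0 (by simpa using ha))
  rw [hasFDerivAt_iff_isLittleO_nhds_zero]
  refine Asymptotics.IsBigO.trans_isLittleO (g := fun h : Fin 2 → ℝ => ‖h‖ ^ 2) ?_
    (Asymptotics.isLittleO_norm_pow_id one_lt_two)
  refine Asymptotics.IsBigO.of_bound (C * (3 * (κ * (2 * a)) ^ 2) * (√Real.pi * a))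
    (Eventually.of_forall fun h => ?_)
  have hreal : ∀ (c : ℝ) (g : C(Plane, ℂ)), c • discVec a g = discVec a ((c : ℂ) • g) := by
    intro c g
    rw [map_smul]
    exact (algebraMap_smul ℂ c (discVec a g)).symm
  have hlin : discVec a (f * wave κ (v + h)) - discVec a (f * wave κ v) -
      (∑ i, (ContinuousLinearMap.proj i : (Fin 2 → ℝ) →L[ℝ] ℝ).smulRight
        (discVec a ((f * ((Complex.I * κ) • coord i)) * wave κ v))) h =
      discVec a (f * wave κ (v + h) - f * wave κ v -
        ((h 0 : ℂ) • ((f * ((Complex.I * κ) • coord 0)) * wave κ v) +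
        (h 1 : ℂ) • ((f * ((Complex.I * κ) • coord 1)) * wave κ v))) := by
    rw [map_sub, map_sub, map_add, ← hreal, ← hreal, Fin.sum_univ_two]
    rfl
  rw [hlin, Real.norm_of_nonneg (by positivity : 0 ≤ ‖h‖ ^ 2)]
  have hb : 0 ≤ C * (3 * (κ * (2 * a)) ^ 2) * ‖h‖ ^ 2 := by positivity
  refine (norm_discVec_le ha hb _ fun r hr => ?_).trans_eq (by ring)
  set y : ℝ := κ * (h 0 * r 0 + h 1 * r 1) with hy
  have hpt : (f * wave κ (v + h) - f * wave κ v -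
        ((h 0 : ℂ) • ((f * ((Complex.I * κ) • coord 0)) * wave κ v) +
        (h 1 : ℂ) • ((f * ((Complex.I * κ) • coord 1)) * wave κ v))) r =
      f r * wave κ v r * (Complex.exp (Complex.I * y) - 1 - Complex.I * y) := by
    have hw : wave κ (v + h) r = wave κ v r * Complex.exp (Complex.I * y) := by
      rw [wave_apply, wave_apply, ← Complex.exp_add, hy]
      congr 1
      simp only [Pi.add_apply]
      push_cast
      ring
    simp only [ContinuousMap.sub_apply, ContinuousMap.add_apply, ContinuousMap.mul_apply,
      ContinuousMap.smul_apply, coord_apply, smul_eq_mul, hw, hy]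
    push_cast
    ring
  rw [hpt, norm_mul, norm_mul, norm_wave, mul_one, mul_assoc C]
  have h1 : ‖f r‖ ≤ C := hC r (by simpa using hr)
  have hri : ∀ i, |r i| ≤ a := fun i => by
    have := PiLp.norm_apply_le r i
    rw [Real.norm_eq_abs] at this
    exact this.trans hr
  have hhi : ∀ i, |h i| ≤ ‖h‖ := fun i => by
    have := norm_le_pi_norm h i
    rwa [Real.norm_eq_abs] at this
  have hyb : y ^ 2 ≤ (κ * (2 * a)) ^ 2 * ‖h‖ ^ 2 := by
    rw [← mul_pow, sq_le_sq, hy, mul_assoc κ, abs_mul, abs_mul κ]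
    refine mul_le_mul_of_nonneg_left ?_ (abs_nonneg _)
    rw [abs_of_nonneg (by positivity : 0 ≤ 2 * a * ‖h‖)]
    calc |h 0 * r 0 + h 1 * r 1| ≤ |h 0 * r 0| + |h 1 * r 1| := abs_add_le _ _
      _ = |h 0| * |r 0| + |h 1| * |r 1| := by rw [abs_mul, abs_mul]
      _ ≤ ‖h‖ * a + ‖h‖ * a := by
          gcongr
          exacts [hhi 0, hri 0, hhi 1, hri 1]
      _ = 2 * a * ‖h‖ := by ring
  refine mul_le_mul h1 ?_ (norm_nonneg _) hC0
  calc _ ≤ 3 * y ^ 2 := norm_exp_I_mul_sub_one_sub_le y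
    _ ≤ 3 * ((κ * (2 * a)) ^ 2 * ‖h‖ ^ 2) := by gcongr
    _ = _ := by ring

/-- The radial part `t ↦ 𝒜 exp (- i κ s₃ t / 2)` of the pupil function, with `t = r²`. -/
noncomputable def radialPhase (κ a s₃ : ℝ) : C(ℝ, ℂ) :=
  ⟨fun t => ((1 / (√Real.pi * a) : ℝ) : ℂ) * Complex.exp (-(Complex.I * (κ * s₃ / 2) * t)),
    by fun_prop⟩

theorem radialPhase_apply (κ a s₃ t : ℝ) : radialPhase κ a s₃ t =
    ((1 / (√Real.pi * a) : ℝ) : ℂ) * Complex.exp (-(Complex.I * (κ * s₃ / 2) * t)) := rfl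

theorem pupilFun_sep (κ a s₃ : ℝ) (v : Fin 2 → ℝ) :
    pupilFun κ a (sep s₃ v) = (Metric.closedBall (0 : Plane) a).indicator
      (rad (radialPhase κ a s₃) * wave κ v) := by
  unfold pupilFun
  refine congrArg (Set.indicator (Metric.closedBall 0 a)) (funext fun r => ?_)
  rw [ContinuousMap.mul_apply, rad_apply, radialPhase_apply, wave_apply, mul_assoc,
    ← Complex.exp_add]
  congr 2
  simp only [sep, Matrix.cons_val_zero, Matrix.cons_val_one, Matrix.cons_val]
  push_cast
  ring

theorem pupil_sep (κ a s₃ : ℝ) (v : Fin 2 → ℝ) :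
    pupil κ a (sep s₃ v) = discVec a (rad (radialPhase κ a s₃) * wave κ v) :=
  toLp_eq_discVec _ _ (pupilFun_sep κ a s₃ v)

/-- Reversing the source position amounts to reversing the wave number. -/
theorem pupil_neg (k a : ℝ) (s : Fin 3 → ℝ) : pupil k a (-s) = pupil (-k) a s := by
  have h : pupilFun k a (-s) = pupilFun (-k) a s := by
    unfold pupilFun
    refine congrArg (Set.indicator (Metric.closedBall 0 a)) (funext fun r => ?_)
    congr 4
    simp only [Pi.neg_apply]
    ring
  simp only [pupil, h]

/-- The partial derivatives of `v ↦ pupil κ a (sep s₃ v)`. -/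
noncomputable def pupilDeriv (κ a s₃ : ℝ) (i : Fin 2) (v : Fin 2 → ℝ) : Photon :=
  discVec a ((rad (radialPhase κ a s₃) * ((Complex.I * κ) • coord i)) * wave κ v)

theorem hasPartials_pupil {a : ℝ} (ha : 0 ≤ a) (κ s₃ : ℝ) :
    HasPartials (fun v => pupil κ a (sep s₃ v)) (pupilDeriv κ a s₃) := by
  simp only [pupil_sep]
  exact hasPartials_discVec_mul_wave ha κ _

theorem continuous_pupilDeriv {a : ℝ} (ha : 0 ≤ a) (κ s₃ : ℝ) (i : Fin 2) :
    Continuous (pupilDeriv κ a s₃ i) :=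
  (hasPartials_discVec_mul_wave ha κ _).continuous

theorem pupil_sep_zero (κ a s₃ : ℝ) :
    pupil κ a (sep s₃ 0) = discVec a (rad (radialPhase κ a s₃)) := by
  rw [pupil_sep, wave_zero, mul_one]

theorem pupilDeriv_zero (κ a s₃ : ℝ) (i : Fin 2) :
    pupilDeriv κ a s₃ i 0 =
      (Complex.I * κ) • discVec a (coord i * rad (radialPhase κ a s₃)) := by
  rw [pupilDeriv, wave_zero, mul_one, ← map_smul, mul_smul_comm, mul_comm (coord i)]

theorem conj_radialPhase (κ a s₃ t : ℝ) :
    (starRingEnd ℂ) (radialPhase κ a s₃ t) = radialPhase (-κ) a s₃ t := by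
  rw [radialPhase_apply, radialPhase_apply, map_mul, ← Complex.exp_conj, Complex.conj_ofReal]
  congr 2
  simp only [map_neg, map_mul, Complex.conj_I, map_div₀, Complex.conj_ofReal, map_ofNat]
  push_cast
  ring

theorem radialPhase_mul {a : ℝ} (κ κ' s₃ t : ℝ) :
    radialPhase κ a s₃ t * radialPhase κ' a s₃ t =
      ((1 / (Real.pi * a ^ 2) : ℝ) : ℂ) * Complex.exp (-(Complex.I * ((κ + κ') * s₃ / 2)) * t) := by
  have h : (1 / (√Real.pi * a)) * (1 / (√Real.pi * a)) = 1 / (Real.pi * a ^ 2) := by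
    rw [div_mul_div_comm, one_mul, mul_mul_mul_comm, Real.mul_self_sqrt Real.pi_pos.le, pow_two]
  rw [radialPhase_apply, radialPhase_apply, mul_mul_mul_comm, ← Complex.ofReal_mul, h,
    ← Complex.exp_add]
  congr 2
  ring

theorem norm_pupil_sep_zero {a : ℝ} (ha : 0 < a) (κ s₃ : ℝ) : ‖pupil κ a (sep s₃ 0)‖ = 1 := by
  have h : inner ℂ (pupil κ a (sep s₃ 0)) (pupil κ a (sep s₃ 0)) = (1 : ℂ) := by
    rw [pupil_sep_zero, inner_rad_rad ha.le]
    simp only [conj_radialPhase, radialPhase_mul]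
    simp only [Complex.ofReal_neg, neg_add_cancel, zero_mul, zero_div, mul_zero, neg_zero,
      Complex.exp_zero, mul_one]
    rw [intervalIntegral.integral_const, Complex.real_smul]
    norm_cast
    field_simp
    simp
  have h2 := inner_self_eq_norm_sq (𝕜 := ℂ) (pupil κ a (sep s₃ 0))
  rw [h, RCLike.one_re] at h2
  exact (pow_eq_one_iff_of_nonneg (norm_nonneg _) two_ne_zero).1 h2.symm

/-- The overlap of the two pupil functions is `|sin y / y|` with `y = κ s₃ a² / 2`, so they are
linearly independent. -/
theorem norm_inner_pupil_lt_one {a κ s₃ : ℝ} (ha : 0 < a) (hκ : κ ≠ 0) (hs : s₃ ≠ 0) :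
    ‖inner ℂ (pupil (-κ) a (sep s₃ 0)) (pupil κ a (sep s₃ 0))‖ < 1 := by
  have hc : -(Complex.I * ((κ + κ) * s₃ / 2)) ≠ 0 := by
    have h1 : ((κ : ℂ) + κ) * s₃ / 2 = κ * s₃ := by ring
    rw [h1]
    simp [hκ, hs]
  have hY : κ * s₃ * a ^ 2 ≠ 0 := by positivity
  have hexp : Complex.exp (-(Complex.I * ((κ + κ) * s₃ / 2)) * ((a ^ 2 : ℝ) : ℂ)) =
      Complex.exp (Complex.I * ((-(κ * s₃ * a ^ 2) : ℝ) : ℂ)) := by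
    congr 1
    push_cast
    ring
  have hn : ‖-(Complex.I * (((κ : ℂ) + κ) * s₃ / 2))‖ = |κ * s₃| := by
    have h1 : ((κ : ℂ) + κ) * s₃ / 2 = ((κ * s₃ : ℝ) : ℂ) := by push_cast; ring
    rw [h1]
    simp
  rw [pupil_sep_zero, pupil_sep_zero, inner_rad_rad ha.le]
  simp only [conj_radialPhase, radialPhase_mul, neg_neg]
  rw [intervalIntegral.integral_const_mul, integral_exp_mul_complex hc, hexp, Complex.ofReal_zero,
    mul_zero, Complex.exp_zero, norm_mul, norm_mul, norm_div, hn,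
    Complex.norm_exp_I_mul_ofReal_sub_one, Complex.norm_real, Complex.norm_real]
  have hsin : ‖2 * Real.sin (-(κ * s₃ * a ^ 2) / 2)‖ < |κ * s₃| * a ^ 2 := by
    rw [norm_mul, Real.norm_eq_abs, Real.norm_eq_abs, abs_two]
    have h1 : -(κ * s₃ * a ^ 2) / 2 ≠ 0 := by
      rw [neg_div]
      exact neg_ne_zero.2 (div_ne_zero hY two_ne_zero)
    have h2 := Real.abs_sin_lt_abs h1
    rw [abs_div, abs_neg, abs_two, abs_mul (κ * s₃), abs_of_pos (by positivity : 0 < a ^ 2)] at h2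
    linarith
  have hpos : 0 < |κ * s₃| := abs_pos.2 (mul_ne_zero hκ hs)
  rw [Real.norm_of_nonneg Real.pi_pos.le, Real.norm_of_nonneg (by positivity)]
  have hπ := Real.pi_pos
  rw [show Real.pi * (1 / (Real.pi * a ^ 2) * (‖2 * Real.sin (-(κ * s₃ * a ^ 2) / 2)‖ / |κ * s₃|))
    = ‖2 * Real.sin (-(κ * s₃ * a ^ 2) / 2)‖ / (|κ * s₃| * a ^ 2) by field_simp]
  rwa [div_lt_one (by positivity)]

theorem state_sep (k a s₃ : ℝ) :
    (fun v => state k a (sep s₃ v)) =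
      fun v => mixture (pupil k a (sep s₃ v)) (pupil (-k) a (sep s₃ v)) := by
  funext v
  rw [state, pupil_neg, mixture]

/-- The two images of the point sources fall under the general theory; the derivatives of the pupil
functions are orthogonal to the pupil functions on the line `s_⊥ = 0` by parity. -/
theorem incoherentPair_pupil {k a s₃ : ℝ} (hk : 0 < k) (ha : 0 < a) (hs : s₃ ≠ 0) :
    IncoherentPair (fun v => pupil k a (sep s₃ v)) (fun v => pupil (-k) a (sep s₃ v))
      (pupilDeriv k a s₃) (pupilDeriv (-k) a s₃) := by
  have horth : ∀ κ κ' i, inner ℂ (pupil κ a (sep s₃ 0)) (pupilDeriv κ' a s₃ i 0) = (0 : ℂ) := by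
    intro κ κ' i
    rw [pupil_sep_zero, pupilDeriv_zero, inner_smul_right, inner_rad_coord, mul_zero]
  exact
    { hasPartials_left := hasPartials_pupil ha.le k s₃
      hasPartials_right := hasPartials_pupil ha.le (-k) s₃
      continuous_left := continuous_pupilDeriv ha.le k s₃
      continuous_right := continuous_pupilDeriv ha.le (-k) s₃
      norm_left := norm_pupil_sep_zero ha k s₃
      norm_right := norm_pupil_sep_zero ha (-k) s₃
      norm_inner_lt_one := norm_inner_pupil_lt_one ha hk.ne' hs
      inner_left_left := horth k k
      inner_right_left := horth (-k) k
      inner_left_right := horth k (-k)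
      inner_right_right := horth (-k) (-k) }

/-! ### The phase is stationary on the line `s_⊥ = 0` -/

/-- `v ↦ ∫ f exp (i κ v · r)` over the disc. -/
noncomputable def waveIntegral (a κ : ℝ) (f : C(Plane, ℂ)) (v : Fin 2 → ℝ) : ℂ :=
  inner ℂ (discVec a 1) (discVec a (f * wave κ v))

theorem waveIntegral_eq (a κ : ℝ) (f : C(Plane, ℂ)) (v : Fin 2 → ℝ) :
    waveIntegral a κ f v = ∫ r in Metric.closedBall (0 : Plane) a, f r * wave κ v r := by
  rw [waveIntegral, inner_discVec]
  simp

theorem hasDerivAt_waveIntegral {a : ℝ} (ha : 0 ≤ a) (κ : ℝ) (f : C(Plane, ℂ)) (i : Fin 2)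
    (t : ℝ) :
    HasDerivAt (fun t : ℝ => waveIntegral a κ f (t • Pi.single i 1))
      (waveIntegral a κ (f * ((Complex.I * κ) • coord i)) (t • Pi.single i 1)) t := by
  have h1 := (hasPartials_discVec_mul_wave ha κ f (t • Pi.single i 1)).comp_hasDerivAt t
    ((hasDerivAt_id t).smul_const (Pi.single i 1 : Fin 2 → ℝ))
  rw [one_smul, sum_smulRight_single] at h1
  exact ((innerSL ℂ (discVec a 1)).restrictScalars ℝ).hasFDerivAt.comp_hasDerivAt t h1

theorem waveIntegral_neg (a κ : ℝ) (F : C(ℝ, ℂ)) (v : Fin 2 → ℝ) :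
    waveIntegral a κ (rad F) (-v) = waveIntegral a κ (rad F) v := by
  rw [waveIntegral_eq, waveIntegral_eq, ← setIntegral_disc_comp a (LinearIsometryEquiv.neg ℝ)]
  congr 1
  funext r
  simp only [LinearIsometryEquiv.coe_neg, rad_apply, norm_neg, wave_apply]
  congr 3
  simp

theorem eventually_eq_zero_deriv {f f' : ℝ → ℂ} (hf : ∀ t, HasDerivAt f (f' t) t)
    (h : ∀ᶠ t in 𝓝 0, f t = 0) : ∀ᶠ t in 𝓝 0, f' t = 0 := by
  have h1 : f =ᶠ[𝓝 0] fun _ => 0 := h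
  filter_upwards [h1.deriv] with t ht
  rw [← (hf t).deriv, ht, deriv_const]

/-- The integrals `∫ exp (ζ t)` and `∫ t exp (ζ t)` over `[0, b]` do not both vanish. -/
theorem integral_exp_ne_zero_or {ζ : ℂ} (hζ : ζ ≠ 0) {b : ℝ} (hb : b ≠ 0)
    (h0 : ∫ t in 0..b, Complex.exp (ζ * t) = 0) : ∫ t in 0..b, t * Complex.exp (ζ * t) ≠ 0 := by
  have h1 : Complex.exp (ζ * b) = 1 := by
    rw [integral_exp_mul_complex hζ, div_eq_zero_iff, or_iff_left hζ] at h0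
    simpa [sub_eq_zero] using h0
  have hcont : Continuous fun t : ℝ => (t : ℂ) * Complex.exp (ζ * t) := by fun_prop
  have h2 : ∫ t in 0..b, t * Complex.exp (ζ * t) = (fun t : ℝ =>
      (t / ζ - 1 / ζ ^ 2) * Complex.exp (ζ * t)) b - (fun t : ℝ =>
      (t / ζ - 1 / ζ ^ 2) * Complex.exp (ζ * t)) 0 := by
    refine intervalIntegral.integral_eq_sub_of_hasDerivAt
      (f := fun t : ℝ => (t / ζ - 1 / ζ ^ 2) * Complex.exp (ζ * t)) (fun t _ => ?_)
      (hcont.intervalIntegrable _ _)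
    have e1 : HasDerivAt (fun t : ℝ => (t : ℂ)) 1 t := Complex.ofRealCLM.hasDerivAt
    have e2 := (e1.div_const ζ).sub_const (1 / ζ ^ 2)
    have e3 := (e1.const_mul ζ).cexp
    refine (e2.mul e3).congr_deriv ?_
    field_simp
    ring
  rw [h2]
  simp only [h1, Complex.ofReal_zero, mul_zero, Complex.exp_zero, mul_one]
  have h3 : (b : ℂ) / ζ - 1 / ζ ^ 2 - (0 / ζ - 1 / ζ ^ 2) = b / ζ := by ring
  rw [h3]
  exact div_ne_zero (Complex.ofReal_ne_zero.2 hb) hζ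

theorem integral_pupilFun_sq (k a s₃ : ℝ) (v : Fin 2 → ℝ) :
    ∫ r, pupilFun k a (sep s₃ v) r ^ 2 =
      waveIntegral a (2 * k) (rad (radialPhase k a s₃ * radialPhase k a s₃)) v := by
  rw [waveIntegral_eq, ← integral_indicator Metric.isClosed_closedBall.measurableSet, pupilFun_sep]
  congr 1
  funext r
  by_cases hr : r ∈ Metric.closedBall (0 : Plane) a
  · rw [Set.indicator_of_mem hr, Set.indicator_of_mem hr]
    have hw : wave (2 * k) v r = wave k v r * wave k v r := by
      rw [wave_apply, wave_apply, ← Complex.exp_add]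
      congr 1
      push_cast
      ring
    simp only [ContinuousMap.mul_apply, rad_apply, hw]
    ring
  · rw [Set.indicator_of_notMem hr, Set.indicator_of_notMem hr]
    simp

/-- `∫ Φ_s²` does not vanish identically near `s_⊥ = 0`, although it may vanish at the point. -/
theorem frequently_integral_pupilFun_sq_ne_zero {k a s₃ : ℝ} (hk : k ≠ 0) (ha : 0 < a)
    (hs : s₃ ≠ 0) (i : Fin 2) :
    ∃ᶠ t : ℝ in 𝓝[≠] 0, ∫ r, pupilFun k a (sep s₃ (t • Pi.single i 1)) r ^ 2 ≠ 0 := by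
  intro hev
  simp only [not_not, integral_pupilFun_sq] at hev
  set f := rad (radialPhase k a s₃ * radialPhase k a s₃) with hf
  set f₁ := f * ((Complex.I * (2 * k : ℝ)) • coord i) with hf₁
  set f₂ := f₁ * ((Complex.I * (2 * k : ℝ)) • coord i) with hf₂
  have hcont : Continuous fun t : ℝ => waveIntegral a (2 * k) f (t • Pi.single i 1) :=
    continuous_iff_continuousAt.2 fun t => (hasDerivAt_waveIntegral ha.le _ f i t).continuousAt
  have h0 : waveIntegral a (2 * k) f ((0 : ℝ) • Pi.single i 1) = 0 := by
    have e1 := (hcont.tendsto 0).mono_left (nhdsWithin_le_nhds (s := {0}ᶜ))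
    have e2 : Tendsto (fun t : ℝ => waveIntegral a (2 * k) f (t • Pi.single i 1)) (𝓝[≠] 0)
        (𝓝 0) := tendsto_const_nhds.congr' (by filter_upwards [hev] with t ht using ht.symm)
    exact tendsto_nhds_unique e1 e2
  have hev0 : ∀ᶠ t : ℝ in 𝓝 0, waveIntegral a (2 * k) f (t • Pi.single i 1) = 0 := by
    rw [eventually_nhdsWithin_iff] at hev
    filter_upwards [hev] with t ht
    rcases eq_or_ne t 0 with rfl | h
    · exact h0
    · exact ht h
  have hev1 := eventually_eq_zero_deriv (fun t => hasDerivAt_waveIntegral ha.le _ f i t) hev0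
  have hev2 := (eventually_eq_zero_deriv
    (fun t => hasDerivAt_waveIntegral ha.le _ f₁ i t) hev1).self_of_nhds
  have hζ : -(Complex.I * ((k + k) * s₃ / 2)) ≠ 0 := by
    have h1 : ((k : ℂ) + k) * s₃ / 2 = k * s₃ := by ring
    rw [h1]
    simp [hk, hs]
  have hA : (((1 / (Real.pi * a ^ 2) : ℝ)) : ℂ) ≠ 0 := by
    rw [Complex.ofReal_ne_zero]
    positivity
  have hπ : (Real.pi : ℂ) ≠ 0 := Complex.ofReal_ne_zero.2 Real.pi_ne_zero
  rw [zero_smul] at h0 hev2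
  rw [waveIntegral_eq, wave_zero] at h0 hev2
  have i0 : ∫ t in 0..a ^ 2, Complex.exp (-(Complex.I * ((k + k) * s₃ / 2)) * t) = 0 := by
    have e1 := setIntegral_disc_radial ha.le (radialPhase k a s₃ * radialPhase k a s₃)
      (by fun_prop)
    simp only [hf, ContinuousMap.one_apply, mul_one, rad_apply] at h0
    rw [ContinuousMap.coe_mul] at h0
    rw [h0] at e1
    simp only [Pi.mul_apply, radialPhase_mul] at e1
    rw [intervalIntegral.integral_const_mul] at e1
    simpa [hπ, hA, ha.ne'] using e1.symm
  refine integral_exp_ne_zero_or hζ (by positivity) i0 ?_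
  have e2 := setIntegral_disc_coord_sq ha.le (radialPhase k a s₃ * radialPhase k a s₃)
    (by fun_prop) i
  have e3 : ∀ r, f₂ r * (1 : C(Plane, ℂ)) r = (Complex.I * (2 * k : ℝ)) ^ 2 *
      ((r i : ℂ) ^ 2 * (radialPhase k a s₃ * radialPhase k a s₃ : ℝ → ℂ) (‖r‖ ^ 2)) := by
    intro r
    simp only [hf₂, hf₁, hf, ContinuousMap.mul_apply, ContinuousMap.smul_apply, coord_apply,
      rad_apply, ContinuousMap.one_apply, smul_eq_mul, Pi.mul_apply]
    ring
  change ∫ r in Metric.closedBall (0 : Plane) a, f₂ r * (1 : C(Plane, ℂ)) r = 0 at hev2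
  simp only [e3] at hev2
  rw [integral_const_mul, e2, mul_eq_zero] at hev2
  have e4 := hev2.resolve_left (by simp [hk])
  simp only [Pi.mul_apply, radialPhase_mul, mul_left_comm _ (((1 / (Real.pi * a ^ 2) : ℝ)) : ℂ)]
    at e4
  rw [intervalIntegral.integral_const_mul] at e4
  simpa [hπ, hA, ha.ne'] using e4

/-- As `∫ Φ_s²` is even in `s_⊥`, the values of the phase at `v` and `-v` agree near `0` wherever
that integral does not vanish, which makes the derivative of the phase vanish. -/
theorem hasDerivAt_phase {k a s₃ : ℝ} (hk : k ≠ 0) (ha : 0 < a) (hs : s₃ ≠ 0)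
    {θ : (Fin 3 → ℝ) → ℝ} (hθ : IsPhase k a θ)
    (hd : DifferentiableAt ℝ (fun v : Fin 2 → ℝ => θ (sep s₃ v)) 0) (i : Fin 2) :
    HasDerivAt (fun t : ℝ => θ (sep s₃ (t • Pi.single i 1))) 0 0 := by
  set ϑ : ℝ → ℝ := fun t => θ (sep s₃ (t • Pi.single i 1)) with hϑ
  obtain ⟨D, hD⟩ : ∃ D, HasDerivAt ϑ D 0 := by
    have h1 := hd.hasFDerivAt.hasLineDerivAt (Pi.single i 1)
    simp only [HasLineDerivAt, zero_add] at h1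
    exact ⟨_, h1⟩
  have hm : HasDerivAt (fun t => ϑ t - ϑ (-t)) (2 * D) 0 := by
    have h2 : HasDerivAt (fun t => ϑ (-t)) (-D) 0 := by
      have h3 : HasDerivAt ϑ D (-0) := by rwa [neg_zero]
      exact (h3.comp (0 : ℝ) (hasDerivAt_neg (0 : ℝ))).congr_deriv (by ring)
    exact (hD.sub h2).congr_deriv (by ring)
  have hsmall : ∀ᶠ t in 𝓝[≠] (0 : ℝ), |ϑ t - ϑ (-t)| < 1 := by
    have h1 := hm.continuousAt.tendsto.abs
    simp only [neg_zero, sub_self, abs_zero] at h1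
    exact (h1.eventually (gt_mem_nhds one_pos)).filter_mono nhdsWithin_le_nhds
  have hfreq : ∃ᶠ t in 𝓝[≠] (0 : ℝ), ϑ t - ϑ (-t) = 0 := by
    refine ((frequently_integral_pupilFun_sq_ne_zero hk ha hs i).and_eventually hsmall).mono ?_
    rintro t ⟨hG, ht⟩
    have r1 := hθ.real (sep s₃ (t • Pi.single i 1))
    have r2 := hθ.real (sep s₃ ((-t) • Pi.single i 1))
    have heven : ∫ r, pupilFun k a (sep s₃ ((-t) • Pi.single i 1)) r ^ 2 =
        ∫ r, pupilFun k a (sep s₃ (t • Pi.single i 1)) r ^ 2 := by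
      rw [integral_pupilFun_sq, integral_pupilFun_sq, neg_smul, waveIntegral_neg]
    rw [heven] at r2
    set G := ∫ r, pupilFun k a (sep s₃ (t • Pi.single i 1)) r ^ 2
    change (Complex.exp (2 * Complex.I * (ϑ t : ℂ)) * G).im = 0 at r1
    change (Complex.exp (2 * Complex.I * (ϑ (-t) : ℂ)) * G).im = 0 at r2
    have hsin : Real.sin (2 * (ϑ t - ϑ (-t))) = 0 := by
      have hz : ∀ x : ℝ, Complex.exp (2 * Complex.I * (x : ℂ)) =
          ((Real.cos (2 * x) : ℝ) : ℂ) + ((Real.sin (2 * x) : ℝ) : ℂ) * Complex.I := by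
        intro x
        rw [show 2 * Complex.I * (x : ℂ) = ((2 * x : ℝ) : ℂ) * Complex.I by push_cast; ring,
          Complex.exp_mul_I, Complex.ofReal_cos, Complex.ofReal_sin]
      rw [hz] at r1 r2
      simp only [Complex.mul_im, Complex.add_re, Complex.add_im, Complex.mul_re,
        Complex.ofReal_re, Complex.ofReal_im, Complex.I_re, Complex.I_im] at r1 r2
      have hGn : G.re ^ 2 + G.im ^ 2 ≠ 0 := by
        intro h0
        apply hG
        apply Complex.ext
        · simp only [Complex.zero_re]
          nlinarith [sq_nonneg G.re, sq_nonneg G.im]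
        · simp only [Complex.zero_im]
          nlinarith [sq_nonneg G.re, sq_nonneg G.im]
      rw [mul_sub, Real.sin_sub]
      refine (mul_eq_zero.1 (?_ : (G.re ^ 2 + G.im ^ 2) * _ = 0)).resolve_left hGn
      generalize Real.cos (2 * ϑ t) = c₁ at *
      generalize Real.sin (2 * ϑ t) = s₁ at *
      generalize Real.cos (2 * ϑ (-t)) = c₂ at *
      generalize Real.sin (2 * ϑ (-t)) = s₂ at *
      linear_combination (c₂ * G.re - s₂ * G.im) * r1 - (c₁ * G.re - s₁ * G.im) * r2
    have hab := abs_lt.1 ht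
    have hπ := Real.pi_gt_three
    have := (Real.sin_eq_zero_iff_of_lt_of_lt (by linarith) (by linarith)).1 hsin
    linarith
  have hslope := hasDerivAt_iff_tendsto_slope_zero.1 hm
  have hD0 : 2 * D = 0 := by
    by_contra hne
    have h1 := hslope.eventually_ne hne
    refine (hfreq.and_eventually h1).exists.elim ?_
    rintro t ⟨h2, h3⟩
    apply h3
    simp [h2]
  rw [mul_eq_zero, or_iff_right two_ne_zero] at hD0
  rwa [hD0] at hD

/-! ### The eigenvectors of the state -/

theorem hasDerivAt_cexp_phase {ϑ : ℝ → ℝ} (h : HasDerivAt ϑ 0 0) (c : ℂ) :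
    HasDerivAt (fun t : ℝ => Complex.exp (c * (ϑ t : ℂ))) 0 0 := by
  refine ((h.ofReal_comp.const_mul c).cexp).congr_deriv ?_
  simp

theorem source_sep_neg {k a : ℝ} {θ : (Fin 3 → ℝ) → ℝ} (hθ : IsPhase k a θ) (s : Fin 3 → ℝ) :
    source k a θ (-s) = Complex.exp (-Complex.I * (θ s : ℂ)) • pupil (-k) a s := by
  rw [source, hθ.odd, pupil_neg]
  congr 2
  push_cast
  ring

/-- The combinations `ε x + ε⁻¹ y` and `-i (ε x - ε⁻¹ y)` with `ε = exp (i θ)`, which relate the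
vectors `ψ̃₁`, `ψ̃₂` to the pupil functions. -/
noncomputable def eigenComb (θ : ℝ) (n : Fin 2) (x y : Photon) : Photon :=
  ![Complex.exp (Complex.I * θ) • x + Complex.exp (-Complex.I * θ) • y,
    (-Complex.I) • (Complex.exp (Complex.I * θ) • x - Complex.exp (-Complex.I * θ) • y)] n

theorem psiTilde_eq {k a : ℝ} {θ : (Fin 3 → ℝ) → ℝ} (hθ : IsPhase k a θ) (n : Fin 2)
    (s : Fin 3 → ℝ) :
    psiTilde k a θ n s = eigenComb (θ s) n (pupil k a s) (pupil (-k) a s) := by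
  rw [psiTilde, source_sep_neg hθ]
  rfl

/-- As the phase has vanishing derivative on the line `s_⊥ = 0`, only the pupil functions are
differentiated. -/
theorem pderiv_psiTilde {k a s₃ : ℝ} (hk : k ≠ 0) (ha : 0 < a) (hs : s₃ ≠ 0)
    {θ : (Fin 3 → ℝ) → ℝ} (hθ : IsPhase k a θ)
    (hd : DifferentiableAt ℝ (fun v : Fin 2 → ℝ => θ (sep s₃ v)) 0) (i n : Fin 2) :
    pderiv i (fun v => psiTilde k a θ n (sep s₃ v)) 0 =
      eigenComb (θ (sep s₃ 0)) n (pupilDeriv k a s₃ i 0) (pupilDeriv (-k) a s₃ i 0) := by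
  have hθ0 := hasDerivAt_phase hk ha hs hθ hd i
  have key : ∀ (c : ℂ) (κ : ℝ),
      HasDerivAt (fun t : ℝ => Complex.exp (c * (θ (sep s₃ (t • Pi.single i 1)) : ℂ)) •
        pupil κ a (sep s₃ (t • Pi.single i 1)))
        (Complex.exp (c * (θ (sep s₃ 0) : ℂ)) • pupilDeriv κ a s₃ i 0) 0 := by
    intro c κ
    have h1 := (hasPartials_pupil ha.le κ s₃ ((0 : ℝ) • Pi.single i 1)).comp_hasDerivAt (0 : ℝ)
      ((hasDerivAt_id (0 : ℝ)).smul_const (Pi.single i 1 : Fin 2 → ℝ))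
    rw [one_smul, sum_smulRight_single] at h1
    refine ((hasDerivAt_cexp_phase hθ0 c).smul h1).congr_deriv ?_
    simp
  rw [pderiv]
  refine HasLineDerivAt.lineDeriv ?_
  rw [HasLineDerivAt]
  simp only [zero_add, psiTilde_eq hθ]
  have h1 := key Complex.I k
  have h2 := key (-Complex.I) (-k)
  fin_cases n
  · exact h1.add h2
  · exact (h1.sub h2).const_smul (-Complex.I)

/-- A relation with a real factor holds for the components of `ψ̃₁` and `ψ̃₂` along the range of a
projector iff it holds for the projections of the two pupil functions. -/
theorem eigenComb_relation_iff {A : Type*} {π : A → Photon} {P : Photon →L[ℂ] Photon}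
    (h : IsProjectorSum P π) (θ c : ℝ) (x y x' y' : Photon) :
    (∀ (n : Fin 2) (α : A), inner ℂ (eigenComb θ n x y) (π α) =
      (c : ℂ) * inner ℂ (eigenComb θ n x' y') (π α)) ↔
      P x = (c : ℂ) • P x' ∧ P y = (c : ℂ) • P y' := by
  simp only [← h.apply_eq_smul_iff, Fin.forall_fin_two]
  have hε : Complex.exp (Complex.I * θ) ≠ 0 := Complex.exp_ne_zero _
  have hε' : Complex.exp (-Complex.I * θ) ≠ 0 := Complex.exp_ne_zero _
  simp only [eigenComb, Matrix.cons_val_zero, Matrix.cons_val_one, map_add, map_sub, map_smul]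
  generalize Complex.exp (Complex.I * θ) = ε at *
  generalize Complex.exp (-Complex.I * θ) = ε' at *
  constructor
  · rintro ⟨h1, h2⟩
    have h3 : ε • P x - ε' • P y = (c : ℂ) • (ε • P x' - ε' • P y') := by
      have := congrArg (fun z => Complex.I • z) h2
      simp only [smul_smul, mul_neg, Complex.I_mul_I, neg_neg, one_smul,
        mul_left_comm Complex.I] at this
      rw [this]
      simp
    constructor
    · refine sub_eq_zero.1 ((smul_eq_zero.1 (?_ : ε • (P x - (c : ℂ) • P x') = 0)).resolve_left hε)
      linear_combination (norm := module) (1 / 2 : ℂ) • h1 + (1 / 2 : ℂ) • h3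
    · refine sub_eq_zero.1
        ((smul_eq_zero.1 (?_ : ε' • (P y - (c : ℂ) • P y') = 0)).resolve_left hε')
      linear_combination (norm := module) (1 / 2 : ℂ) • h1 - (1 / 2 : ℂ) • h3
  · rintro ⟨h1, h2⟩
    rw [h1, h2]
    constructor <;> module

open Polynomial

/-! ### The radial Zernike polynomials of azimuthal order one -/

theorem ascPochhammer_eval_add_one_mul (n : ℕ) (y : ℝ) :
    y * (ascPochhammer ℝ n).eval (y + 1) = (ascPochhammer ℝ n).eval y * (y + n) := by
  rw [← ascPochhammer_succ_eval, ascPochhammer_succ_left]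
  simp

/-- The `n`-th difference of `1 / y` is `(-1)ⁿ n! / (y (y + 1) ⋯ (y + n))`. -/
theorem fwdDiff_iter_inv (n : ℕ) {y : ℝ} (hy : 0 < y) :
    (fwdDiff 1)^[n] (fun x : ℝ => x⁻¹) y =
      (-1) ^ n * n.factorial / (ascPochhammer ℝ (n + 1)).eval y := by
  induction n generalizing y with
  | zero => simp
  | succ n ih =>
    have hy1 : 0 < y + 1 := by linarith
    have hyn : 0 < y + n + 1 := by positivity
    rw [Function.iterate_succ_apply', fwdDiff, ih hy1, ih hy, ascPochhammer_succ_eval (n + 1) y]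
    have h1 := ascPochhammer_eval_add_one_mul (n + 1) y
    have p1 := ascPochhammer_pos (n + 1) y hy
    have p2 := ascPochhammer_pos (n + 1) (y + 1) hy1
    generalize (ascPochhammer ℝ (n + 1)).eval y = A at *
    generalize (ascPochhammer ℝ (n + 1)).eval (y + 1) = B at *
    push_cast at h1 ⊢
    have hB : B = A * (y + (n + 1)) / y := by
      field_simp
      linarith
    have hyn' : y + ((n : ℝ) + 1) ≠ 0 := by positivity
    rw [hB, Nat.factorial_succ]
    push_cast
    field_simp
    ring

theorem fwdDiff_iter_eval_zero (n : ℕ) (f : ℝ → ℝ) :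
    (fwdDiff 1)^[n] f 0 =
      ∑ i ∈ Finset.range (n + 1), (-1 : ℝ) ^ (n - i) * n.choose i * f i := by
  rw [fwdDiff_iter_eq_sum_shift]
  refine Finset.sum_congr rfl fun i _ => ?_
  simp

/-- A partial fraction identity: the polynomial part of `Q / (X + z)` is killed by the `n`-th
difference. -/
theorem sum_choose_mul_eval_div (n : ℕ) (Q : ℝ[X]) (hQ : Q.natDegree ≤ n) {z : ℝ} (hz : 0 < z) :
    ∑ i ∈ Finset.range (n + 1), (-1 : ℝ) ^ (n - i) * n.choose i * (Q.eval (i : ℝ) / (i + z)) =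
      Q.eval (-z) * ((-1) ^ n * n.factorial / (ascPochhammer ℝ (n + 1)).eval z) := by
  set q := Q /ₘ (X - C (-z)) with hq
  have hdiv : ∀ x : ℝ, Q.eval x = Q.eval (-z) + (x + z) * q.eval x := by
    intro x
    have h1 := modByMonic_add_div Q (X - C (-z))
    rw [modByMonic_X_sub_C_eq_C_eval] at h1
    conv_lhs => rw [← h1]
    simp [hq]
  have hq0 : ∑ i ∈ Finset.range (n + 1), (-1 : ℝ) ^ (n - i) * n.choose i * q.eval (i : ℝ) = 0 := by
    rw [← fwdDiff_iter_eval_zero n (fun x => q.eval x)]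
    rcases Nat.eq_zero_or_pos n with rfl | hn
    · have hq00 : q = 0 := by
        rw [hq, divByMonic_eq_zero_iff (monic_X_sub_C _), degree_X_sub_C,
          eq_C_of_natDegree_eq_zero (Nat.le_zero.1 hQ)]
        exact degree_C_le.trans_lt (by norm_num)
      simp [hq00]
    · have hdeg : q.natDegree < n := by
        rw [hq, natDegree_divByMonic _ (monic_X_sub_C _), natDegree_X_sub_C]
        omega
      exact congrFun (fwdDiff_iter_eq_zero_of_degree_lt hdeg) 0
  have hinv : ∑ i ∈ Finset.range (n + 1), (-1 : ℝ) ^ (n - i) * n.choose i * (z + i)⁻¹ =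
      (-1) ^ n * n.factorial / (ascPochhammer ℝ (n + 1)).eval z := by
    rw [← fwdDiff_iter_inv n hz, fwdDiff_iter_eq_sum_shift]
    refine Finset.sum_congr rfl fun i _ => ?_
    simp
  rw [← hinv, Finset.mul_sum, ← sub_eq_zero, ← Finset.sum_sub_distrib]
  refine (Finset.sum_congr rfl fun i _ => ?_).trans hq0
  have hne : (i : ℝ) + z ≠ 0 := by positivity
  rw [hdiv (i : ℝ), add_div, mul_div_cancel_left₀ _ hne, add_comm z, div_eq_mul_inv]
  ring

/-- The polynomial `P` with `R_{2n+1}^1(ρ) = ρ P(ρ²)`. -/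
noncomputable def zernikePoly (n : ℕ) : ℝ[X] :=
  ∑ i ∈ Finset.range (n + 1), C ((-1 : ℝ) ^ (n - i) * n.choose i *
    (ascPochhammer ℝ n).eval ((i : ℝ) + 2) / n.factorial) * X ^ i

theorem zernikePoly_eval (n : ℕ) (x : ℝ) : (zernikePoly n).eval x =
    ∑ i ∈ Finset.range (n + 1), ((-1 : ℝ) ^ (n - i) * n.choose i *
    (ascPochhammer ℝ n).eval ((i : ℝ) + 2) / n.factorial) * x ^ i := by
  simp [zernikePoly, eval_finsetSum]

theorem zernikePoly_coeff_self (n : ℕ) : (zernikePoly n).coeff n =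
    (ascPochhammer ℝ n).eval ((n : ℝ) + 2) / n.factorial := by
  simp [zernikePoly, coeff_C_mul, coeff_X_pow]

theorem zernikePoly_coeff_self_pos (n : ℕ) : 0 < (zernikePoly n).coeff n := by
  rw [zernikePoly_coeff_self]
  have := ascPochhammer_pos n ((n : ℝ) + 2) (by positivity)
  positivity

theorem natDegree_zernikePoly_le (n : ℕ) : (zernikePoly n).natDegree ≤ n := by
  refine natDegree_sum_le_of_forall_le _ _ fun i hi => ?_
  exact (natDegree_C_mul_X_pow_le _ _).trans (Nat.lt_succ_iff.1 (Finset.mem_range.1 hi))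

theorem degree_zernikePoly (n : ℕ) : (zernikePoly n).degree = n :=
  le_antisymm (natDegree_le_iff_degree_le.1 (natDegree_zernikePoly_le n))
    (le_degree_of_ne_zero (zernikePoly_coeff_self_pos n).ne')

/-- The moments of `x P(x)` of order below `n` vanish. -/
theorem integral_mul_pow_mul_zernikePoly (n l : ℕ) (hl : l ≤ n) :
    ∫ x in (0 : ℝ)..1, x * (x ^ l * (zernikePoly n).eval x) =
      if l = n then n.factorial / (ascPochhammer ℝ (n + 1)).eval ((n : ℝ) + 2) else 0 := by
  have h1 : ∫ x in (0 : ℝ)..1, x * (x ^ l * (zernikePoly n).eval x) =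
      1 / n.factorial * ∑ i ∈ Finset.range (n + 1), (-1 : ℝ) ^ (n - i) * n.choose i *
        (((ascPochhammer ℝ n).comp (X + C 2)).eval (i : ℝ) / (i + ((l : ℝ) + 2))) := by
    have h2 : ∀ x : ℝ, x * (x ^ l * (zernikePoly n).eval x) =
        ∑ i ∈ Finset.range (n + 1), ((-1 : ℝ) ^ (n - i) * n.choose i *
          (ascPochhammer ℝ n).eval ((i : ℝ) + 2) / n.factorial) * x ^ (i + l + 1) := by
      intro x
      rw [zernikePoly_eval, Finset.mul_sum, Finset.mul_sum]
      refine Finset.sum_congr rfl fun i _ => ?_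
      ring
    simp only [h2]
    rw [intervalIntegral.integral_finsetSum
      fun i _ => Continuous.intervalIntegrable (by fun_prop) _ _, Finset.mul_sum]
    refine Finset.sum_congr rfl fun i _ => ?_
    rw [intervalIntegral.integral_const_mul, integral_pow]
    have hne : (i : ℝ) + (l + 2) ≠ 0 := by positivity
    simp only [one_pow, eval_comp, eval_add, eval_X, eval_C]
    push_cast
    rw [zero_pow (by omega), sub_zero, show (i : ℝ) + l + 1 + 1 = i + (l + 2) by ring]
    field_simp
  have hdeg : ((ascPochhammer ℝ n).comp (X + C 2)).natDegree ≤ n := by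
    rw [natDegree_comp, ascPochhammer_natDegree, natDegree_X_add_C, mul_one]
  rw [h1, sum_choose_mul_eval_div n _ hdeg (by positivity : (0 : ℝ) < l + 2)]
  have h3 : ((ascPochhammer ℝ n).comp (X + C 2)).eval (-((l : ℝ) + 2)) =
      (ascPochhammer ℝ n).eval (-(l : ℝ)) := by
    simp only [eval_comp, eval_add, eval_X, eval_C]
    congr 1
    ring
  rw [h3]
  split_ifs with h
  · subst h
    rw [ascPochhammer_eval_neg_eq_descPochhammer, descPochhammer_eval_eq_descFactorial,
      Nat.descFactorial_self]
    have h4 : ((-1 : ℝ) ^ l) * (-1) ^ l = 1 := by rw [← mul_pow]; simp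
    have hp := ascPochhammer_pos (l + 1) ((l : ℝ) + 2) (by positivity)
    field_simp
    linear_combination h4
  · rw [ascPochhammer_eval_neg_coe_nat_of_lt (lt_of_le_of_ne hl h)]
    simp

theorem integral_mul_eval_mul_zernikePoly (n : ℕ) (p : ℝ[X]) (hp : p.natDegree ≤ n) :
    ∫ x in (0 : ℝ)..1, x * (p.eval x * (zernikePoly n).eval x) =
      p.coeff n * (n.factorial / (ascPochhammer ℝ (n + 1)).eval ((n : ℝ) + 2)) := by
  have h2 : ∀ x : ℝ, x * (p.eval x * (zernikePoly n).eval x) =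
      ∑ l ∈ Finset.range (n + 1), p.coeff l * (x * (x ^ l * (zernikePoly n).eval x)) := by
    intro x
    rw [eval_eq_sum_range' (Nat.lt_succ_of_le hp) x, Finset.sum_mul, Finset.mul_sum]
    refine Finset.sum_congr rfl fun i _ => ?_
    ring
  simp only [h2]
  rw [intervalIntegral.integral_finsetSum
      fun i _ => Continuous.intervalIntegrable (by fun_prop) _ _]
  rw [Finset.sum_eq_single n]
  · rw [intervalIntegral.integral_const_mul, integral_mul_pow_mul_zernikePoly n n le_rfl, if_pos rfl]
  · intro l hl hne
    rw [intervalIntegral.integral_const_mul, integral_mul_pow_mul_zernikePoly n l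
      (Nat.lt_succ_iff.1 (Finset.mem_range.1 hl)), if_neg hne, mul_zero]
  · intro h
    exact absurd (Finset.self_mem_range_succ n) h

/-- Orthogonality of the Zernike polynomials. -/
theorem integral_zernikePoly_mul (m n : ℕ) :
    ∫ x in (0 : ℝ)..1, x * ((zernikePoly m).eval x * (zernikePoly n).eval x) =
      if m = n then (1 / (2 * (n : ℝ) + 2) : ℝ) else 0 := by
  have hlt : ∀ m n : ℕ, m < n →
      ∫ x in (0 : ℝ)..1, x * ((zernikePoly m).eval x * (zernikePoly n).eval x) = 0 := by
    intro m n h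
    rw [integral_mul_eval_mul_zernikePoly n _ ((natDegree_zernikePoly_le m).trans h.le),
      coeff_eq_zero_of_natDegree_lt ((natDegree_zernikePoly_le m).trans_lt h), zero_mul]
  rcases lt_trichotomy m n with h | h | h
  · rw [hlt m n h, if_neg h.ne]
  · subst h
    rw [integral_mul_eval_mul_zernikePoly m _ (natDegree_zernikePoly_le m), if_pos rfl,
      zernikePoly_coeff_self, ascPochhammer_succ_eval]
    have hp := ascPochhammer_pos m ((m : ℝ) + 2) (by positivity)
    field_simp
    ring
  · rw [if_neg h.ne']
    simp only [mul_comm ((zernikePoly m).eval _)]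
    exact hlt n m h

theorem zernikeRadial_odd (n : ℕ) (ρ : ℝ) :
    zernikeRadial (2 * n + 1) 1 ρ = ρ * (zernikePoly n).eval (ρ ^ 2) := by
  rw [zernikeRadial, zernikePoly_eval, Finset.mul_sum]
  rw [show (2 * n + 1 - 1) / 2 = n by omega, show (2 * n + 1 + 1) / 2 = n + 1 by omega,
    ← Finset.sum_range_reflect]
  refine Finset.sum_congr rfl fun i hi => ?_
  have hi' : i ≤ n := Nat.lt_succ_iff.1 (Finset.mem_range.1 hi)
  obtain ⟨d, rfl⟩ := Nat.exists_eq_add_of_le hi'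
  have e1 : i + d + 1 - 1 - i = d := by omega
  rw [e1, show 2 * (i + d) + 1 - d = (i + 1) + (i + d) by omega,
    show i + d + 1 - d = i + 1 by omega, show i + d - d = i by omega,
    show i + d - i = d by omega, show 2 * (i + d) + 1 - 2 * d = 2 * i + 1 by omega]
  have h1 : ((ascPochhammer ℝ (i + d)).eval ((i : ℝ) + 2)) * ((i + 1).factorial : ℝ) =
      (((i + 1) + (i + d)).factorial : ℝ) := by
    rw [← Nat.factorial_mul_ascFactorial (i + 1) (i + d), Nat.cast_mul, Nat.cast_ascFactorial, mul_comm]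
    congr 2
    push_cast
    ring
  have h2 : ((i + d).choose i : ℝ) * (i.factorial * d.factorial) = (i + d).factorial := by
    have := Nat.choose_mul_factorial_mul_factorial (Nat.le_add_right i d)
    rw [Nat.add_sub_cancel_left] at this
    rw [← this]
    push_cast
    ring
  have h3 : ((i + d).choose i : ℝ) ≠ 0 :=
    Nat.cast_ne_zero.2 (Nat.choose_pos (Nat.le_add_right i d)).ne'
  rw [← h1, ← h2]
  field_simp
  ring

/-! ### Zernike vectors of azimuthal order `± 1` -/

/-- The azimuthal index whose angular factor is `x_i / r`: `cos φ` for `i = 0`, `sin φ` for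
`i = 1`. -/
def azimuthal (i : Fin 2) : ℤ := ![1, -1] i

/-- The function `t ↦ p (t / a²)`. -/
noncomputable def scaledPoly (a : ℝ) (p : ℝ[X]) : C(ℝ, ℂ) :=
  ⟨fun t => ((p.eval (t / a ^ 2) : ℝ) : ℂ), by fun_prop⟩

theorem scaledPoly_apply (a : ℝ) (p : ℝ[X]) (t : ℝ) :
    scaledPoly a p t = ((p.eval (t / a ^ 2) : ℝ) : ℂ) := rfl

/-- The normalization constant of `Z_{2n+1}^{±1}` relative to `x_i P_n(r² / a²)`. -/
noncomputable def zernikeNorm (a : ℝ) (n : ℕ) : ℝ :=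
  √(2 * ((2 * n + 1 : ℕ) + 1)) / (√Real.pi * a) / a

theorem zernikeNorm_ne_zero {a : ℝ} (ha : 0 < a) (n : ℕ) : zernikeNorm a n ≠ 0 := by
  have := Real.pi_pos
  unfold zernikeNorm
  positivity

theorem zernikeNorm_sq {a : ℝ} (ha : 0 < a) (n : ℕ) :
    zernikeNorm a n * zernikeNorm a n * (Real.pi / 2 * a ^ 4) = 2 * n + 2 := by
  have h1 : √(2 * ((2 * n + 1 : ℕ) + 1)) * √(2 * ((2 * n + 1 : ℕ) + 1)) =
      2 * ((2 * n + 1 : ℕ) + 1 : ℝ) := Real.mul_self_sqrt (by positivity)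
  have h2 := Real.mul_self_sqrt Real.pi_pos.le
  have h3 : √Real.pi ≠ 0 := (Real.sqrt_pos.2 Real.pi_pos).ne'
  unfold zernikeNorm
  generalize √(2 * ((2 * n + 1 : ℕ) + 1 : ℝ)) = s at *
  generalize √Real.pi = p at *
  generalize Real.pi = q at *
  subst h2
  field_simp
  push_cast at h1
  linear_combination h1

theorem norm_mul_zernikeAngular (i : Fin 2) (r : Plane) :
    ‖r‖ * zernikeAngular (azimuthal i) (Complex.arg ⟨r 0, r 1⟩) = r i := by
  have hn : ‖r‖ = ‖(⟨r 0, r 1⟩ : ℂ)‖ := by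
    rw [EuclideanSpace.norm_eq, Complex.norm_eq_sqrt_sq_add_sq]
    simp
  rw [hn]
  fin_cases i
  · simp [zernikeAngular, azimuthal]
  · simp [zernikeAngular, azimuthal]

/-- `Z_{2n+1}^{±1}` is a coordinate function times a polynomial in `r²`. -/
theorem zernike_eq (a : ℝ) (n : ℕ) (i : Fin 2) :
    zernike a (2 * n + 1) (azimuthal i) =
      (zernikeNorm a n : ℂ) • discVec a (coord i * rad (scaledPoly a (zernikePoly n))) := by
  rw [← map_smul]
  refine toLp_eq_discVec _ _ ?_
  unfold zernikeFun
  refine congrArg (Set.indicator (Metric.closedBall 0 a)) (funext fun r => ?_)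
  have h0 : azimuthal i ≠ 0 := by fin_cases i <;> simp [azimuthal]
  have h1 : (azimuthal i).natAbs = 1 := by fin_cases i <;> simp [azimuthal]
  simp only [ContinuousMap.smul_apply, ContinuousMap.mul_apply, coord_apply, rad_apply,
    scaledPoly_apply, smul_eq_mul, if_neg h0, h1, zernikeRadial_odd]
  rw [← norm_mul_zernikeAngular i r, zernikeNorm, div_pow]
  push_cast
  ring

theorem inner_coord_scaledPoly {a : ℝ} (ha : 0 < a) (p q : ℝ[X]) (i : Fin 2) :
    inner ℂ (discVec a (coord i * rad (scaledPoly a p)))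
      (discVec a (coord i * rad (scaledPoly a q))) =
      ((Real.pi / 2 * a ^ 4 * ∫ x in (0 : ℝ)..1, x * (p.eval x * q.eval x) : ℝ) : ℂ) := by
  rw [inner_coord_coord_self ha.le]
  have h1 : ∀ t : ℝ, (t : ℂ) * ((starRingEnd ℂ) (scaledPoly a p t) * scaledPoly a q t) =
      ((a ^ 2 * ((t / a ^ 2) * (p.eval (t / a ^ 2) * q.eval (t / a ^ 2))) : ℝ) : ℂ) := by
    intro t
    rw [scaledPoly_apply, scaledPoly_apply, Complex.conj_ofReal]
    norm_cast
    field_simp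
  simp only [h1]
  rw [intervalIntegral.integral_ofReal, intervalIntegral.integral_const_mul,
    intervalIntegral.integral_comp_div (fun x => x * (p.eval x * q.eval x)) (by positivity),
    zero_div, div_self (by positivity)]
  push_cast
  simp only [smul_eq_mul]
  push_cast
  ring

theorem inner_zernike_self {a : ℝ} (ha : 0 < a) (i : Fin 2) (m n : ℕ) :
    inner ℂ (zernike a (2 * m + 1) (azimuthal i)) (zernike a (2 * n + 1) (azimuthal i)) =
      if m = n then (1 : ℂ) else 0 := by
  rw [zernike_eq, zernike_eq, inner_smul_left, inner_smul_right, inner_coord_scaledPoly ha,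
    integral_zernikePoly_mul, Complex.conj_ofReal]
  split_ifs with h
  · subst h
    have h1 := zernikeNorm_sq ha m
    have h2 : (2 * (m : ℝ) + 2) ≠ 0 := by positivity
    norm_cast
    rw [← mul_assoc, ← mul_assoc]
    rw [h1]
    field_simp
    push_cast
    ring
  · simp

theorem orthonormal_zernike {a : ℝ} (ha : 0 < a) (i : Fin 2) :
    Orthonormal ℂ fun n : ℕ => zernike a (2 * n + 1) (azimuthal i) :=
  orthonormal_iff_ite.2 fun m n => inner_zernike_self ha i m n

theorem inner_zernike_rad (a : ℝ) (i : Fin 2) (n : ℕ) (F : C(ℝ, ℂ)) :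
    inner ℂ (zernike a (2 * n + 1) (azimuthal i)) (discVec a (rad F)) = 0 := by
  rw [zernike_eq, inner_smul_left, inner_coord_rad, mul_zero]

theorem inner_zernike_coord_of_ne (a : ℝ) {i j : Fin 2} (h : j ≠ i) (n : ℕ) (F : C(ℝ, ℂ)) :
    inner ℂ (zernike a (2 * n + 1) (azimuthal i)) (discVec a (coord j * rad F)) = 0 := by
  rw [zernike_eq, inner_smul_left, inner_coord_coord_of_ne a _ _ h, mul_zero]

theorem span_zernikePoly : Submodule.span ℝ (Set.range zernikePoly) = ⊤ := by
  let S : Polynomial.Sequence ℝ := ⟨zernikePoly, degree_zernikePoly⟩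
  exact S.span fun n => (leadingCoeff_ne_zero.2 (S.ne_zero n)).isUnit

theorem discVec_scaledPoly_mem_span {a : ℝ} (ha : 0 < a) (i : Fin 2) (p : ℝ[X]) :
    discVec a (coord i * rad (scaledPoly a p)) ∈
      Submodule.span ℂ (Set.range fun n : ℕ => zernike a (2 * n + 1) (azimuthal i)) := by
  have hp : p ∈ Submodule.span ℝ (Set.range zernikePoly) := by
    rw [span_zernikePoly]
    trivial
  induction hp using Submodule.span_induction with
  | mem p hp =>
    obtain ⟨n, rfl⟩ := hp
    have h1 : discVec a (coord i * rad (scaledPoly a (zernikePoly n))) =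
        ((zernikeNorm a n : ℂ)⁻¹) • zernike a (2 * n + 1) (azimuthal i) := by
      rw [zernike_eq, smul_smul,
        inv_mul_cancel₀ (Complex.ofReal_ne_zero.2 (zernikeNorm_ne_zero ha n)), one_smul]
    rw [h1]
    exact Submodule.smul_mem _ _ (Submodule.subset_span ⟨n, rfl⟩)
  | zero =>
    have h1 : coord i * rad (scaledPoly a 0) = 0 := by
      ext r
      simp [rad_apply, scaledPoly_apply]
    rw [h1, map_zero]
    exact Submodule.zero_mem _
  | add p q _ _ hp hq =>
    have h1 : coord i * rad (scaledPoly a (p + q)) =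
        coord i * rad (scaledPoly a p) + coord i * rad (scaledPoly a q) := by
      ext r
      simp [rad_apply, scaledPoly_apply, mul_add]
    rw [h1, map_add]
    exact Submodule.add_mem _ hp hq
  | smul c p _ hp =>
    have h1 : coord i * rad (scaledPoly a (c • p)) =
        (c : ℂ) • (coord i * rad (scaledPoly a p)) := by
      ext r
      simp [rad_apply, scaledPoly_apply]
      ring
    rw [h1, map_smul]
    exact Submodule.smul_mem _ _ hp

/-- The partial sums of the series of `exp (ζ t)`. -/
noncomputable def expPartial (ζ : ℂ) (N : ℕ) : C(ℝ, ℂ) :=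
  ⟨fun t => ∑ m ∈ Finset.range N, (ζ * t) ^ m / m.factorial, by fun_prop⟩

/-- The function `t ↦ exp (ζ t)`. -/
noncomputable def expRadial (ζ : ℂ) : C(ℝ, ℂ) := ⟨fun t => Complex.exp (ζ * t), by fun_prop⟩

theorem discVec_expPartial_mem_span {a : ℝ} (ha : 0 < a) (i : Fin 2) (ζ : ℂ) (N : ℕ) :
    discVec a (coord i * rad (expPartial ζ N)) ∈
      Submodule.span ℂ (Set.range fun n : ℕ => zernike a (2 * n + 1) (azimuthal i)) := by
  have h1 : coord i * rad (expPartial ζ N) = ∑ m ∈ Finset.range N,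
      (ζ ^ m * a ^ (2 * m) / m.factorial) • (coord i * rad (scaledPoly a (X ^ m))) := by
    ext r
    simp only [ContinuousMap.mul_apply, ContinuousMap.coe_sum, Finset.sum_apply,
      ContinuousMap.smul_apply, rad_apply, scaledPoly_apply, eval_pow, eval_X, smul_eq_mul]
    change _ * ∑ m ∈ Finset.range N, (ζ * ((‖r‖ ^ 2 : ℝ) : ℂ)) ^ m / m.factorial = _
    rw [Finset.mul_sum]
    refine Finset.sum_congr rfl fun m _ => ?_
    have ha' : (a : ℂ) ≠ 0 := Complex.ofReal_ne_zero.2 ha.ne'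
    push_cast
    rw [mul_pow, div_pow, pow_mul]
    field_simp
  rw [h1, map_sum]
  refine Submodule.sum_mem _ fun m _ => ?_
  rw [map_smul]
  exact Submodule.smul_mem _ _ (discVec_scaledPoly_mem_span ha i _)

/-- Completeness: on the disc `x_i exp (ζ r²)` is the `L²` limit of the products of `x_i` with
polynomials in `r²`, which are spanned by the Zernike functions. -/
theorem discVec_exp_mem_closure {a : ℝ} (ha : 0 < a) (i : Fin 2) (ζ : ℂ) :
    discVec a (coord i * rad (expRadial ζ)) ∈
      (Submodule.span ℂ
        (Set.range fun n : ℕ => zernike a (2 * n + 1) (azimuthal i))).topologicalClosure := by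
  set R : ℝ := ‖ζ‖ * a ^ 2 with hR
  have hR0 : 0 ≤ R := by positivity
  have htend : Tendsto (fun N => discVec a (coord i * rad (expPartial ζ N))) atTop
      (𝓝 (discVec a (coord i * rad (expRadial ζ)))) := by
    rw [tendsto_iff_norm_sub_tendsto_zero]
    have hlim : Tendsto (fun N : ℕ => a * (R ^ N / N.factorial * 2) * (√Real.pi * a)) atTop
        (𝓝 0) := by
      have h1 := (((FloorSemiring.tendsto_pow_div_factorial_atTop R).mul_const 2).const_mul
        a).mul_const (√Real.pi * a)
      simpa using h1
    refine squeeze_zero' (Eventually.of_forall fun _ => norm_nonneg _) ?_ hlim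
    filter_upwards [eventually_ge_atTop ⌈2 * R⌉₊] with N hN
    rw [← map_sub]
    refine norm_discVec_le ha.le (by positivity) _ fun r hr => ?_
    have hsplit : (coord i * rad (expPartial ζ N) - coord i * rad (expRadial ζ)) r =
        -((r i : ℂ) * (Complex.exp (ζ * ((‖r‖ ^ 2 : ℝ) : ℂ)) -
          ∑ m ∈ Finset.range N, (ζ * ((‖r‖ ^ 2 : ℝ) : ℂ)) ^ m / m.factorial)) := by
      simp only [ContinuousMap.sub_apply, ContinuousMap.mul_apply, coord_apply, rad_apply]
      change _ * (∑ m ∈ Finset.range N, (ζ * ((‖r‖ ^ 2 : ℝ) : ℂ)) ^ m / m.factorial) -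
        _ * Complex.exp (ζ * ((‖r‖ ^ 2 : ℝ) : ℂ)) = _
      ring
    have hz : ‖ζ * ((‖r‖ ^ 2 : ℝ) : ℂ)‖ ≤ R := by
      rw [norm_mul, Complex.norm_real, Real.norm_of_nonneg (by positivity), hR]
      gcongr
    have hN' : ‖ζ * ((‖r‖ ^ 2 : ℝ) : ℂ)‖ / (N.succ : ℝ) ≤ 1 / 2 := by
      rw [div_le_iff₀ (by positivity)]
      have h2 := Nat.ceil_le.1 hN
      rw [Nat.cast_succ]
      linarith
    have hri : ‖(r i : ℂ)‖ ≤ a := by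
      rw [Complex.norm_real]
      exact (PiLp.norm_apply_le r i).trans hr
    rw [hsplit, norm_neg, norm_mul]
    refine mul_le_mul hri ?_ (norm_nonneg _) ha.le
    refine (Complex.exp_bound' hN').trans ?_
    gcongr
  exact mem_closure_of_tendsto htend
    (Eventually.of_forall fun N => discVec_expPartial_mem_span ha i ζ N)

/-- The derivatives of the pupil functions lie in the closed span of the Zernike functions. -/
theorem pupilDeriv_mem_closure {a : ℝ} (ha : 0 < a) (κ s₃ : ℝ) (i : Fin 2) :
    pupilDeriv κ a s₃ i 0 ∈ (Submodule.span ℂ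
        (Set.range fun n : ℕ => zernike a (2 * n + 1) (azimuthal i))).topologicalClosure := by
  have h1 : coord i * rad (radialPhase κ a s₃) = ((1 / (√Real.pi * a) : ℝ) : ℂ) •
      (coord i * rad (expRadial (-(Complex.I * (κ * s₃ / 2))))) := by
    ext r
    simp only [ContinuousMap.mul_apply, ContinuousMap.smul_apply, rad_apply, radialPhase_apply,
      smul_eq_mul]
    change _ = _ * (_ * Complex.exp (-(Complex.I * (κ * s₃ / 2)) * ((‖r‖ ^ 2 : ℝ) : ℂ)))
    rw [neg_mul]
    ring
  rw [pupilDeriv_zero, h1, map_smul]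
  exact Submodule.smul_mem _ _ (Submodule.smul_mem _ _ (discVec_exp_mem_closure ha i _))

/-- The norm of `∂ᵢΦ = i κ xᵢ Φ` is a second moment of the uniform distribution on the disc. -/
theorem pupilDeriv_ne_zero {k a : ℝ} (hk : k ≠ 0) (ha : 0 < a) (s₃ : ℝ) (i : Fin 2) :
    pupilDeriv k a s₃ i 0 ≠ 0 := by
  rw [pupilDeriv_zero, smul_ne_zero_iff]
  refine ⟨by simp [hk], fun h => ?_⟩
  have h1 := inner_coord_coord_self ha.le (radialPhase k a s₃) (radialPhase k a s₃) i
  rw [h, inner_zero_left] at h1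
  simp only [conj_radialPhase, radialPhase_mul] at h1
  simp only [Complex.ofReal_neg, neg_add_cancel, zero_mul, zero_div, mul_zero, neg_zero,
    Complex.exp_zero, mul_one] at h1
  rw [intervalIntegral.integral_mul_const, intervalIntegral.integral_ofReal, integral_id,
    zero_pow two_ne_zero, sub_zero] at h1
  have hπ := Real.pi_pos
  norm_cast at h1
  have : 0 < Real.pi / 2 * ((a ^ 2) ^ 2 / 2 * (1 / (Real.pi * a ^ 2))) := by
    positivity
  exact this.ne h1

/-! ### The Zernike measurement -/

section ZernikeProjector

variable {a : ℝ} {Q : Fin 2 → Photon →L[ℂ] Photon}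

theorem zernikeProjector_pupil
    (hQ : ∀ i, IsProjectorSum (Q i) fun n : ℕ => zernike a (2 * n + 1) (azimuthal i))
    (κ s₃ : ℝ) (i : Fin 2) : Q i (pupil κ a (sep s₃ 0)) = 0 := by
  rw [(hQ i).apply_eq_zero_iff]
  intro n
  rw [pupil_sep_zero, inner_zernike_rad]

theorem zernikeProjector_pupilDeriv_self (ha : 0 < a)
    (hQ : ∀ i, IsProjectorSum (Q i) fun n : ℕ => zernike a (2 * n + 1) (azimuthal i))
    (κ s₃ : ℝ) (i : Fin 2) : Q i (pupilDeriv κ a s₃ i 0) = pupilDeriv κ a s₃ i 0 :=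
  (hQ i).apply_eq_self (pupilDeriv_mem_closure ha κ s₃ i)

theorem zernikeProjector_pupilDeriv_of_ne
    (hQ : ∀ i, IsProjectorSum (Q i) fun n : ℕ => zernike a (2 * n + 1) (azimuthal i))
    (κ s₃ : ℝ) {i j : Fin 2} (h : j ≠ i) : Q i (pupilDeriv κ a s₃ j 0) = 0 := by
  rw [(hQ i).apply_eq_zero_iff]
  intro n
  rw [pupilDeriv_zero, inner_smul_right, inner_zernike_coord_of_ne a h, mul_zero]

theorem zernikeProjector_mul_of_ne
    (hQ : ∀ i, IsProjectorSum (Q i) fun n : ℕ => zernike a (2 * n + 1) (azimuthal i))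
    {i j : Fin 2} (h : j ≠ i) : Q i * Q j = 0 := by
  refine ContinuousLinearMap.ext fun x => ?_
  change Q i (Q j x) = 0
  rw [(hQ i).apply_eq_zero_iff]
  intro n
  rw [← starProjection_inner_left (hQ j).isStarProjection]
  have h1 : Q j (zernike a (2 * n + 1) (azimuthal i)) = 0 := by
    rw [(hQ j).apply_eq_zero_iff]
    intro m
    rw [zernike_eq a n i, inner_smul_right, inner_zernike_coord_of_ne a h.symm, mul_zero]
  rw [h1, inner_zero_left]

end ZernikeProjector

/-- The Zernike projectors annihilate the pupil functions and each fixes the derivatives in one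
coordinate, so that both saturation criteria hold with zero factors. Along `δ` the second order
coefficient of the probability of `P₂`, `P₃` is proportional to `δ₁²`, `δ₂²`, so neither limit
degenerates. -/
theorem exists_optimal_measurement {k a s₃ : ℝ} (hk : 0 < k) (ha : 0 < a) (hs₃ : s₃ ≠ 0)
    {L : Fin 2 → Photon →L[ℂ] Photon}
    (hL : ∀ i, IsSLD (fun v => mixture (pupil k a (sep s₃ v)) (pupil (-k) a (sep s₃ v))) 0 i
      (L i)) :
    ∃ P₁ P₂ P₃ : Photon →L[ℂ] Photon,
      IsProjectorSum P₂ (fun n : ℕ => zernike a (2 * n + 1) 1) ∧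
      IsProjectorSum P₃ (fun n : ℕ => zernike a (2 * n + 1) (-1)) ∧
      P₁ = 1 - P₂ - P₃ ∧
      ¬ IsNull (fun v => mixture (pupil k a (sep s₃ v)) (pupil (-k) a (sep s₃ v))) P₁ 0 ∧
      IsNull (fun v => mixture (pupil k a (sep s₃ v)) (pupil (-k) a (sep s₃ v))) P₂ 0 ∧
      IsNull (fun v => mixture (pupil k a (sep s₃ v)) (pupil (-k) a (sep s₃ v))) P₃ 0 ∧
      IsOptimalMeasurement (fun v => mixture (pupil k a (sep s₃ v)) (pupil (-k) a (sep s₃ v))) 0 L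
        ![P₁, P₂, P₃] ∧
      ∀ δ : Fin 2 → ℝ, δ 0 ≠ 0 → δ 1 ≠ 0 → ∀ i j : Fin 2,
        Tendsto
          (fun t : ℝ => ∑ l, cfi
            (fun v => mixture (pupil k a (sep s₃ v)) (pupil (-k) a (sep s₃ v)))
            (![P₁, P₂, P₃] l) (t • δ) i j)
          (𝓝[≠] 0)
          (𝓝 (helstrom (fun v => mixture (pupil k a (sep s₃ v)) (pupil (-k) a (sep s₃ v)))
            0 L i j)) := by
  have h := incoherentPair_pupil hk ha hs₃
  choose Q hQ using fun i => exists_isProjectorSum (orthonormal_zernike ha i)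
  have hQs : ∀ i, IsStarProjection (Q i) := fun i => (hQ i).isStarProjection
  set P₁ : Photon →L[ℂ] Photon := 1 - Q 0 - Q 1 with hP₁
  have hP₁s : IsStarProjection P₁ := by
    rw [hP₁, sub_sub]
    exact ((hQs 0).add (hQs 1) (zernikeProjector_mul_of_ne hQ (by decide))).one_sub
  have hP₁a : ∀ x, P₁ x = x - Q 0 x - Q 1 x := fun x => rfl
  have hP₁u : ∀ κ, P₁ (pupil κ a (sep s₃ 0)) = pupil κ a (sep s₃ 0) := fun κ => by
    rw [hP₁a, zernikeProjector_pupil hQ, zernikeProjector_pupil hQ, sub_zero, sub_zero]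
  have hP₁d : ∀ κ i, P₁ (pupilDeriv κ a s₃ i 0) = 0 := fun κ i => by
    rw [hP₁a]
    fin_cases i
    · change pupilDeriv κ a s₃ 0 0 - Q 0 (pupilDeriv κ a s₃ 0 0) - Q 1 (pupilDeriv κ a s₃ 0 0) = 0
      rw [zernikeProjector_pupilDeriv_self ha hQ,
        zernikeProjector_pupilDeriv_of_ne hQ κ s₃ (by decide), sub_self, sub_zero]
    · change pupilDeriv κ a s₃ 1 0 - Q 0 (pupilDeriv κ a s₃ 1 0) - Q 1 (pupilDeriv κ a s₃ 1 0) = 0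
      rw [zernikeProjector_pupilDeriv_self ha hQ,
        zernikeProjector_pupilDeriv_of_ne hQ κ s₃ (by decide), sub_zero, sub_self]
  have hn₁ : ¬ IsNull (fun v => mixture (pupil k a (sep s₃ v)) (pupil (-k) a (sep s₃ v))) P₁ 0 := by
    rw [isNull_mixture_iff hP₁s, amplitude, RealPair.mk_eq_zero, hP₁u]
    intro h0
    have h1 := norm_pupil_sep_zero ha k s₃
    rw [h0.1, norm_zero] at h1
    exact zero_ne_one h1
  have hn : ∀ i, IsNull (fun v => mixture (pupil k a (sep s₃ v)) (pupil (-k) a (sep s₃ v)))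
      (Q i) 0 := by
    intro i
    rw [isNull_mixture_iff (hQs i), amplitude, RealPair.mk_eq_zero]
    exact ⟨zernikeProjector_pupil hQ k s₃ i, zernikeProjector_pupil hQ (-k) s₃ i⟩
  have hsat₁ : BoundSaturated (fun v => mixture (pupil k a (sep s₃ v)) (pupil (-k) a (sep s₃ v)))
      0 L P₁ := by
    rw [h.boundSaturated_regular_iff hP₁s hL hn₁]
    refine ⟨0, fun i => ?_⟩
    simp [hP₁d]
  have hsat : ∀ l, BoundSaturated
      (fun v => mixture (pupil k a (sep s₃ v)) (pupil (-k) a (sep s₃ v))) 0 L (Q l) := by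
    intro l
    rw [h.boundSaturated_null_iff (hQs l) hL (hn l)]
    intro i j
    by_cases hi : i = l
    · by_cases hj : j = l
      · exact Or.inl ⟨1, by simp [hi, hj]⟩
      · refine Or.inr ⟨0, ?_⟩
        rw [zernikeProjector_pupilDeriv_of_ne hQ k s₃ hj,
          zernikeProjector_pupilDeriv_of_ne hQ (-k) s₃ hj]
        simp
    · refine Or.inl ⟨0, ?_⟩
      rw [zernikeProjector_pupilDeriv_of_ne hQ k s₃ hi,
        zernikeProjector_pupilDeriv_of_ne hQ (-k) s₃ hi]
      simp
  have hamp : ∀ (δ : Fin 2 → ℝ) (l : Fin 2), δ l ≠ 0 →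
      ∑ i, δ i • amplitude (Q l) (pupilDeriv k a s₃ i) (pupilDeriv (-k) a s₃ i) 0 ≠ 0 := by
    intro δ l hδ
    rw [Finset.sum_eq_single l]
    · refine smul_ne_zero hδ ?_
      rw [amplitude, Ne, RealPair.mk_eq_zero, zernikeProjector_pupilDeriv_self ha hQ]
      exact fun h0 => pupilDeriv_ne_zero hk.ne' ha s₃ l h0.1
    · intro i _ hi
      rw [amplitude, zernikeProjector_pupilDeriv_of_ne hQ k s₃ hi,
        zernikeProjector_pupilDeriv_of_ne hQ (-k) s₃ hi, (RealPair.mk_eq_zero _ _).2 ⟨rfl, rfl⟩,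
        smul_zero]
    · simp
  have hsum : P₁ + Q 0 + Q 1 = 1 := by
    rw [hP₁]
    abel
  refine ⟨P₁, Q 0, Q 1, hQ 0, hQ 1, rfl, hn₁, hn 0, hn 1, ⟨?_, ?_, ?_⟩, ?_⟩
  · intro l
    fin_cases l
    exacts [hP₁s, hQs 0, hQs 1]
  · rw [Fin.sum_univ_three]
    exact hsum
  · intro l
    fin_cases l
    exacts [hsat₁, hsat 0, hsat 1]
  · intro δ hδ0 hδ1 i j
    simp only [Fin.sum_univ_three]
    rw [← qfi_add_qfi_add_qfi hsum i j]
    exact ((h.tendsto_cfi_regular hP₁s hn₁ hsat₁ δ i j).add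
      (h.tendsto_cfi_of_saturated_null (hQs 0) (hn 0) (hsat 0) (hamp δ 0 hδ0) i j)).add
      (h.tendsto_cfi_of_saturated_null (hQs 1) (hn 1) (hsat 1) (hamp δ 1 hδ1) i j)

end TwoSources

theorem corollary2 (k a s₃ : ℝ) (hk : 0 < k) (ha : 0 < a) (hs₃ : s₃ ≠ 0)
    (ρ : (Fin 2 → ℝ) → TwoSources.Photon →L[ℂ] TwoSources.Photon)
    (hρ : ρ = fun v => TwoSources.state k a (TwoSources.sep s₃ v)) :
    -- the symmetric logarithmic derivatives of the transverse parameters exist on the line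
    (∃ L : Fin 2 → TwoSources.Photon →L[ℂ] TwoSources.Photon,
      ∀ i, QuantumEstimation.IsSLD ρ 0 i (L i)) ∧
    -- and, whichever are taken:
    ∀ L : Fin 2 → TwoSources.Photon →L[ℂ] TwoSources.Photon,
      (∀ i, QuantumEstimation.IsSLD ρ 0 i (L i)) →
      -- saturation conditions for an arbitrary projector
      (∀ θ : (Fin 3 → ℝ) → ℝ, TwoSources.IsPhase k a θ →
        DifferentiableAt ℝ (fun v : Fin 2 → ℝ => θ (TwoSources.sep s₃ v)) 0 →
        ∀ ψ : Fin 2 → (Fin 2 → ℝ) → TwoSources.Photon,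
          (ψ = fun n v => TwoSources.psiTilde k a θ n (TwoSources.sep s₃ v)) →
        ∀ (A : Type*) (π : A → TwoSources.Photon)
          (P : TwoSources.Photon →L[ℂ] TwoSources.Photon),
          QuantumEstimation.IsProjectorSum P π →
          (¬ QuantumEstimation.IsNull ρ P 0 →
            (QuantumEstimation.BoundSaturated ρ 0 L P ↔
              ∃ ξ : Fin 2 → ℝ, ∀ (i n : Fin 2) (α : A),
                inner ℂ (QuantumEstimation.pderiv i (ψ n) 0) (π α) =
                  (ξ i : ℂ) * inner ℂ (ψ n 0) (π α))) ∧
          (QuantumEstimation.IsNull ρ P 0 →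
            (QuantumEstimation.BoundSaturated ρ 0 L P ↔
              ∀ i j : Fin 2,
                (∃ η : ℝ, ∀ (n : Fin 2) (α : A),
                  inner ℂ (QuantumEstimation.pderiv i (ψ n) 0) (π α) =
                    (η : ℂ) * inner ℂ (QuantumEstimation.pderiv j (ψ n) 0) (π α)) ∨
                (∃ η : ℝ, ∀ (n : Fin 2) (α : A),
                  inner ℂ (QuantumEstimation.pderiv j (ψ n) 0) (π α) =
                    (η : ℂ) * inner ℂ (QuantumEstimation.pderiv i (ψ n) 0) (π α))))) ∧
      -- the optimal measurement
      ∃ P₁ P₂ P₃ : TwoSources.Photon →L[ℂ] TwoSources.Photon,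
        QuantumEstimation.IsProjectorSum P₂ (fun n : ℕ => TwoSources.zernike a (2 * n + 1) 1) ∧
        QuantumEstimation.IsProjectorSum P₃ (fun n : ℕ => TwoSources.zernike a (2 * n + 1) (-1)) ∧
        P₁ = 1 - P₂ - P₃ ∧
        ¬ QuantumEstimation.IsNull ρ P₁ 0 ∧
        QuantumEstimation.IsNull ρ P₂ 0 ∧
        QuantumEstimation.IsNull ρ P₃ 0 ∧
        QuantumEstimation.IsOptimalMeasurement ρ 0 L ![P₁, P₂, P₃] ∧
        -- its classical Fisher information attains the Helstrom matrix
        ∀ δ : Fin 2 → ℝ, δ 0 ≠ 0 → δ 1 ≠ 0 → ∀ i j : Fin 2,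
          Tendsto
            (fun t : ℝ => ∑ l, QuantumEstimation.cfi ρ (![P₁, P₂, P₃] l) (t • δ) i j)
            (𝓝[≠] 0) (𝓝 (QuantumEstimation.helstrom ρ 0 L i j)) := by
  have h := TwoSources.incoherentPair_pupil hk ha hs₃
  rw [TwoSources.state_sep] at hρ
  subst hρ
  refine ⟨Classical.skolem.1 h.exists_sld, fun L hL => ⟨?_,
    TwoSources.exists_optimal_measurement hk ha hs₃ hL⟩⟩
  intro θ hθ hd ψ hψ A π P hP
  subst hψ
  simp only [TwoSources.pderiv_psiTilde hk.ne' ha hs₃ hθ hd]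
  simp only [TwoSources.psiTilde_eq hθ, TwoSources.eigenComb_relation_iff hP]
  refine ⟨fun hn => ?_, fun hn => h.boundSaturated_null_iff hP.isStarProjection hL hn⟩
  exact h.boundSaturated_regular_iff hP.isStarProjection hL hn
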